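/- Let $k,q,m,\ell\ge 0$ be integers with $q\ge 1$, $2\ell\le m$, $k\le q^m$ and $k^2\ne 2q^m$. Let $A$ and $B$ be systems of $m$ qudits of local dimension $q$, i.e. $A\cong B\cong(\mathbb C^q)^{\otimes m}$, and let $A^kB^k=A_1\cdots A_kB_1\cdots B_k$ denote $k$ copies of each. For $X\in\{A,B,AB\}$ let $$\mathcal T_X(\cdot)=\int_{\mathcal U(X)} U^{\otimes k}\,(\cdot)\,(U^\dagger)^{\otimes k}\,dU$$ be the $k$-fold twirl with respect to the Haar probability measure on the unitary group of $X$. Let $\mathbb F_{A_i^\ell B_i^\ell}$ be the operator that swaps the first $\ell$ qudits of $A_i$ with the first $\ell$ qudits of $B_i$, and let $\mathrm{SWAP}_\ell(Y)=F\,Y\,F$ with $F=\bigotimes_{i=1}^k\mathbb F_{A_i^\ell B_i^\ell}$. On the space $\mathcal L(A^kB^k)$ of operators with the Hilbert–Schmidt norm $\|Y\|_2=\operatorname{tr}(Y^\dagger Y)^{1/2}$ put $$\mathcal P=\mathcal T_A\otimes\mathcal T_B,\qquad \mathcal Q=\mathrm{SWAP}_\ell\circ\mathcal P\circ\mathrm{SWAP}_\ell,\qquad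 \mathcal R=\mathcal T_{AB},$$ and let the subspace angle of $\operatorname{im}\mathcal P$ and $\operatorname{im}\mathcal Q$ be $$c(\operatorname{im}\mathcal P,\operatorname{im}\mathcal Q):=\|\mathcal Q\mathcal P-\mathcal R\|_{2\to2}=\sup_{Y\ne0}\frac{\|\mathcal Q\mathcal P(Y)-\mathcal R(Y)\|_2}{\|Y\|_2}.$$ Then, with $a=\left(1-\frac{k^2}{2q^m}\right)^{-2}$, $$c(\operatorname{im}\mathcal P,\operatorname{im}\mathcal Q)\le\sqrt{9\,a\,k^2\,q^{-m}+4\,a^2\,(k!)^3\,q^{-2\ell}+2\,a^2\,(k!)^5\,q^{-4\ell}}.$$ -/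

import Mathlib

open Matrix MeasureTheory
open scoped Kronecker TensorProduct

noncomputable section

namespace TwirlSwap

section Haar

variable (n : Type) [Fintype n] [DecidableEq n]

instance compactSpace_unitaryGroup : CompactSpace (unitaryGroup n ℂ) := by
  have hclosed : IsClosed {U : Matrix n n ℂ | U ∈ unitaryGroup n ℂ} := by
    have h : {U : Matrix n n ℂ | U ∈ unitaryGroup n ℂ} = {U | U * star U = 1} := by
      ext U
      exact mem_unitaryGroup_iff
    rw [h]
    exact isClosed_eq (by fun_prop) continuous_const
  have hK : IsCompact (Set.pi Set.univ fun _ : n => Set.pi Set.univ fun _ : n =>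
      Metric.closedBall (0 : ℂ) 1) :=
    isCompact_univ_pi fun _ => isCompact_univ_pi fun _ => isCompact_closedBall 0 1
  have hc : IsCompact {U : Matrix n n ℂ | U ∈ unitaryGroup n ℂ} := by
    refine IsCompact.of_isClosed_subset (X := Matrix n n ℂ) hK hclosed ?_
    intro U hU i _ j _
    simpa using entry_norm_bound_of_unitary hU i j
  exact isCompact_iff_compactSpace.mp hc

instance measurableSpace_unitaryGroup : MeasurableSpace (unitaryGroup n ℂ) := borel _

instance borelSpace_unitaryGroup : BorelSpace (unitaryGroup n ℂ) := ⟨rfl⟩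

/-- The Haar probability measure on the unitary group of `ℂⁿ`. -/
def haarUnitary : Measure (unitaryGroup n ℂ) :=
  Measure.haarMeasure (⊤ : TopologicalSpace.PositiveCompacts (unitaryGroup n ℂ))

instance isHaarMeasure_haarUnitary : (haarUnitary n).IsHaarMeasure := by
  unfold haarUnitary
  infer_instance

instance isProbabilityMeasure_haarUnitary : IsProbabilityMeasure (haarUnitary n) :=
  ⟨by
    have h := Measure.haarMeasure_self
      (K₀ := (⊤ : TopologicalSpace.PositiveCompacts (unitaryGroup n ℂ)))
    simpa [haarUnitary] using h⟩

end Haar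

section Twirl

variable {n : Type} [Fintype n] [DecidableEq n]

/-- The tensor power `U^{⊗k}`, a matrix on `(ℂⁿ)^{⊗k}`, whose standard basis is indexed by
`Fin k → n`. -/
def tensorPow (k : ℕ) (U : Matrix n n ℂ) : Matrix (Fin k → n) (Fin k → n) ℂ :=
  Matrix.of fun x y => ∏ i, U (x i) (y i)

theorem continuous_tensorPow {n : Type} (k : ℕ) :
    Continuous (tensorPow k : Matrix n n ℂ → Matrix (Fin k → n) (Fin k → n) ℂ) := by
  refine continuous_matrix fun x y => ?_
  simp only [tensorPow, Matrix.of_apply]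
  fun_prop

theorem integrable_twirl_entry (k : ℕ) (X : Matrix (Fin k → n) (Fin k → n) ℂ)
    (x y : Fin k → n) :
    Integrable (fun U : unitaryGroup n ℂ =>
      (tensorPow k (U : Matrix n n ℂ) * X * (tensorPow k (U : Matrix n n ℂ))ᴴ) x y)
      (haarUnitary n) := by
  have hc : Continuous fun U : unitaryGroup n ℂ => tensorPow k (U : Matrix n n ℂ) :=
    (continuous_tensorPow k).comp continuous_subtype_val
  have h : Continuous fun U : unitaryGroup n ℂ =>
      (tensorPow k (U : Matrix n n ℂ) * X * (tensorPow k (U : Matrix n n ℂ))ᴴ) x y :=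
    ((hc.matrix_mul continuous_const).matrix_mul hc.matrix_conjTranspose).matrix_elem x y
  exact h.integrable_of_hasCompactSupport (HasCompactSupport.of_compactSpace _)

/-- The `k`-fold twirl `X ↦ ∫ U^{⊗k} X (U^{⊗k})† dU` over the unitary group of `ℂⁿ`. The integral
of the matrix-valued function is taken entrywise. -/
def twirl (n : Type) [Fintype n] [DecidableEq n] (k : ℕ) :
    Matrix (Fin k → n) (Fin k → n) ℂ →ₗ[ℂ] Matrix (Fin k → n) (Fin k → n) ℂ where
  toFun X := Matrix.of fun x y => ∫ U : unitaryGroup n ℂ,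
    (tensorPow k (U : Matrix n n ℂ) * X * (tensorPow k (U : Matrix n n ℂ))ᴴ) x y ∂(haarUnitary n)
  map_add' X Y := by
    ext x y
    simp only [Matrix.of_apply, Matrix.add_apply, Matrix.mul_add, Matrix.add_mul]
    exact integral_add (integrable_twirl_entry k X x y) (integrable_twirl_entry k Y x y)
  map_smul' c X := by
    ext x y
    simp only [Matrix.of_apply, Matrix.smul_apply, Matrix.mul_smul, Matrix.smul_mul,
      RingHom.id_apply, smul_eq_mul]
    exact integral_const_mul _ _

end Twirl

section Tensor

variable {a b : Type} [Fintype a] [DecidableEq a] [Fintype b] [DecidableEq b]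

/-- The identification of `L(ℂᵃ) ⊗ L(ℂᵇ)` with `L(ℂᵃ ⊗ ℂᵇ)` that sends `X ⊗ Y` to the
Kronecker product of `X` and `Y`. -/
def kroneckerEquiv (a b : Type) [Fintype a] [DecidableEq a] [Fintype b] [DecidableEq b] :
    (Matrix a a ℂ ⊗[ℂ] Matrix b b ℂ) ≃ₗ[ℂ] Matrix (a × b) (a × b) ℂ :=
  kroneckerTMulLinearEquiv a a b b ℂ ℂ ℂ ℂ ≪≫ₗ (TensorProduct.lid ℂ ℂ).mapMatrix

theorem kroneckerEquiv_tmul (X : Matrix a a ℂ) (Y : Matrix b b ℂ) :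
    kroneckerEquiv a b (X ⊗ₜ[ℂ] Y) = X ⊗ₖ Y := by
  ext i j
  simp [kroneckerEquiv, kroneckerTMulLinearEquiv_tmul, kroneckerMap_apply]

/-- The tensor product `Φ ⊗ Ψ` of linear maps on `L(ℂᵃ)` and `L(ℂᵇ)`, acting on `L(ℂᵃ ⊗ ℂᵇ)`. -/
def superTensor (Φ : Matrix a a ℂ →ₗ[ℂ] Matrix a a ℂ) (Ψ : Matrix b b ℂ →ₗ[ℂ] Matrix b b ℂ) :
    Matrix (a × b) (a × b) ℂ →ₗ[ℂ] Matrix (a × b) (a × b) ℂ :=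
  (kroneckerEquiv a b).toLinearMap ∘ₗ TensorProduct.map Φ Ψ ∘ₗ
    (kroneckerEquiv a b).symm.toLinearMap

theorem superTensor_kronecker (Φ : Matrix a a ℂ →ₗ[ℂ] Matrix a a ℂ)
    (Ψ : Matrix b b ℂ →ₗ[ℂ] Matrix b b ℂ) (X : Matrix a a ℂ) (Y : Matrix b b ℂ) :
    superTensor Φ Ψ (X ⊗ₖ Y) = Φ X ⊗ₖ Ψ Y := by
  have h : (kroneckerEquiv a b).symm (X ⊗ₖ Y) = X ⊗ₜ[ℂ] Y := by
    rw [LinearEquiv.symm_apply_eq, kroneckerEquiv_tmul]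
  simp [superTensor, h, kroneckerEquiv_tmul]

end Tensor

section Norm

theorem exists_bound_of_finiteDimensional {E : Type} [NormedAddCommGroup E] [NormedSpace ℂ E]
    [FiniteDimensional ℂ E] (Φ : E →ₗ[ℂ] E) : ∃ C : ℝ, ∀ x, ‖Φ x‖ ≤ C * ‖x‖ :=
  ⟨‖LinearMap.toContinuousLinearMap Φ‖, (LinearMap.toContinuousLinearMap Φ).le_opNorm⟩

variable {n : Type} [Fintype n]

/-- The Hilbert–Schmidt (Schatten 2-) norm `‖X‖₂ = tr(X† X)^{1/2}`. -/
def hsNorm (X : Matrix n n ℂ) : ℝ := Real.sqrt (Xᴴ * X).trace.re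

/-- The norm `‖Φ‖_{2→2} = sup_{X ≠ 0} ‖Φ(X)‖₂ / ‖X‖₂` of a linear map on operators. -/
def norm22 (Φ : Matrix n n ℂ →ₗ[ℂ] Matrix n n ℂ) : ℝ :=
  sSup {r : ℝ | ∃ X : Matrix n n ℂ, X ≠ 0 ∧ r = hsNorm (Φ X) / hsNorm X}

attribute [local instance] Matrix.frobeniusNormedAddCommGroup Matrix.frobeniusNormedSpace in
/-- The set whose supremum is `‖Φ‖_{2→2}` is bounded, so the supremum is a genuine one. -/
theorem bddAbove_norm22 (Φ : Matrix n n ℂ →ₗ[ℂ] Matrix n n ℂ) :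
    BddAbove {r : ℝ | ∃ X : Matrix n n ℂ, X ≠ 0 ∧ r = hsNorm (Φ X) / hsNorm X} := by
  have hs : ∀ X : Matrix n n ℂ, hsNorm X = ‖X‖ := by
    intro X
    rw [frobenius_norm_def, hsNorm, Real.sqrt_eq_rpow]
    congr 1
    simp only [Matrix.trace, Matrix.diag_apply, Matrix.mul_apply, Matrix.conjTranspose_apply,
      Complex.re_sum]
    rw [Finset.sum_comm]
    refine Finset.sum_congr rfl fun i _ => Finset.sum_congr rfl fun j _ => ?_
    have h := Complex.normSq_eq_conj_mul_self (z := X i j)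
    rw [← Complex.star_def] at h
    rw [← h, Complex.ofReal_re, Complex.normSq_eq_norm_sq]
    norm_cast
  obtain ⟨C, hC⟩ := exists_bound_of_finiteDimensional Φ
  refine ⟨C, ?_⟩
  rintro r ⟨X, hX, rfl⟩
  rw [hs, hs]
  exact (div_le_iff₀ (norm_pos_iff.mpr hX)).mpr (hC X)

end Norm

/-- The standard basis of one block of `m` qudits of local dimension `q`. -/
abbrev Block (q m : ℕ) : Type := Fin m → Fin q

/-- The standard basis of `A^k B^k = A₁…A_k B₁…B_k`, where `A` and `B` are blocks of `m` qudits
of local dimension `q`. -/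
abbrev Full (k q m : ℕ) : Type := (Fin k → Block q m) × (Fin k → Block q m)

/-- The linear operators on `A^k B^k`. -/
abbrev Op (k q m : ℕ) : Type := Matrix (Full k q m) (Full k q m) ℂ

/-- The regrouping of `A₁B₁…A_kB_k` as `A₁…A_k B₁…B_k`, on operators. -/
def regroup (k q m : ℕ) :
    Matrix (Fin k → Block q m × Block q m) (Fin k → Block q m × Block q m) ℂ ≃ₗ[ℂ] Op k q m :=
  Matrix.reindexLinearEquiv ℂ ℂ
    (Equiv.arrowProdEquivProdArrow (Fin k) (fun _ => Block q m) (fun _ => Block q m))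
    (Equiv.arrowProdEquivProdArrow (Fin k) (fun _ => Block q m) (fun _ => Block q m))

/-- The exchange of the first `ℓ` qudits of `A` with the first `ℓ` qudits of `B`, on basis
labels. -/
def swapFirst {q m : ℕ} (ℓ : ℕ) (v : Block q m × Block q m) : Block q m × Block q m :=
  (fun j => if j.val < ℓ then v.2 j else v.1 j, fun j => if j.val < ℓ then v.1 j else v.2 j)

/-- The operator on `A ⊗ B` that swaps the first `ℓ` qudits of `A` with those of `B`. -/
def swapOp (q m ℓ : ℕ) : Matrix (Block q m × Block q m) (Block q m × Block q m) ℂ :=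
  Matrix.of fun v w => if v = swapFirst ℓ w then 1 else 0

/-- `SWAP_ℓ`: conjugation of operators on `A^k B^k` by the `k`-fold tensor power of `swapOp`. -/
def SWAP (k q m ℓ : ℕ) : Op k q m →ₗ[ℂ] Op k q m :=
  LinearMap.mulLeftRight ℂ
    (regroup k q m (tensorPow k (swapOp q m ℓ)), regroup k q m (tensorPow k (swapOp q m ℓ)))

/-- `P = T_A ⊗ T_B`. -/
def P (k q m : ℕ) : Op k q m →ₗ[ℂ] Op k q m :=
  superTensor (twirl (Block q m) k) (twirl (Block q m) k)

/-- `Q = SWAP_ℓ ∘ P ∘ SWAP_ℓ`. -/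
def Q (k q m ℓ : ℕ) : Op k q m →ₗ[ℂ] Op k q m :=
  SWAP k q m ℓ ∘ₗ P k q m ∘ₗ SWAP k q m ℓ

/-- `R = T_{AB}`, the `k`-fold twirl over the unitary group of `A ⊗ B`. -/
def R (k q m : ℕ) : Op k q m →ₗ[ℂ] Op k q m :=
  (regroup k q m).toLinearMap ∘ₗ twirl (Block q m × Block q m) k ∘ₗ
    (regroup k q m).symm.toLinearMap

/-- The subspace angle `c(im P, im Q) = ‖Q P - R‖_{2→2}`. -/
def subspaceAngle (k q m ℓ : ℕ) : ℝ := norm22 (Q k q m ℓ ∘ₗ P k q m - R k q m)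

end TwirlSwap

end

/-! By Schur–Weyl duality, with `k ≤ q ^ m`, the three maps are orthogonal projections for the
Hilbert–Schmidt inner product. `P` projects onto the span of the operators `π ⊗ σ`, where `π` and
`σ` permute the copies of `A` and of `B`. `Q` projects onto the swapped versions of these, and `R`
onto the span of the diagonal pairs `σ ⊗ σ`, which the swap fixes (`projectionTriple`).

After normalisation the `(k!)²` vectors of each family are almost orthonormal. Every overlap within
a family, and every overlap between the families other than that of a diagonal pair with itself, is
at most `t = q^(-2ℓ)`. An overlap is a proportion of basis labels satisfying equations that decouple
over the `m` qudits, so it can be counted (`swapCount_le`, `swapCount_zero_le`). A general estimate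
on such families (`ProjectionTriple.norm_apply_le_of_almost_orthonormal`) then bounds the angle by
`(8/3) (k!)² t` whenever `(k!)² t ≤ 1/4`.

The middle term `B = 4 a² (k!)³ t` under the root suffices. The angle never exceeds `1`, so only `B
< 1` matters. If `k² < 2q^m`, then `a ≥ 1`, and the angle is at most `u = 4 (k!)³ t`, with `u² ≤ u ≤
B` once `u < 1`. If `k² > 2q^m`, then `B ≥ 1` (`one_le_bound_of_large`). -/

namespace TwirlSwap

/-! ### Angles between spans of almost orthonormal families in an inner product space. -/

section Projections

open scoped InnerProductSpace

variable {E : Type*} [NormedAddCommGroup E] [InnerProductSpace ℂ E]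

theorem norm_symm_proj_le {P : E →ₗ[ℂ] E} (hP : P.IsSymmetric) (hPP : ∀ x, P (P x) = P x) (x : E) :
    ‖P x‖ ≤ ‖x‖ := by
  have h : ‖P x‖ * ‖P x‖ ≤ ‖P x‖ * ‖x‖ := by
    calc ‖P x‖ * ‖P x‖ = ‖⟪P x, P x⟫_ℂ‖ := by
          rw [inner_self_eq_norm_sq_to_K]; simp [sq]
      _ = ‖⟪P x, x⟫_ℂ‖ := by rw [← hP (P x) x, hPP]
      _ ≤ _ := norm_inner_le_norm _ _
  rcases (norm_nonneg (P x)).eq_or_lt with h0 | h0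
  · rw [← h0]; exact norm_nonneg x
  · exact le_of_mul_le_mul_left h h0

theorem apply_eq_self_of_mem_span {ι : Type*} {P : E →ₗ[ℂ] E} {e : ι → E} (he : ∀ i, P (e i) = e i)
    {x : E} (hx : x ∈ Submodule.span ℂ (Set.range e)) : P x = x := by
  induction hx using Submodule.span_induction with
  | mem x h => obtain ⟨i, rfl⟩ := h; exact he i
  | zero => simp
  | add x y _ _ hx hy => rw [map_add, hx, hy]
  | smul c x _ hx => rw [map_smul, hx]

/-- `P`, `Q`, `R` are the orthogonal projections onto the spans of the families `e`, `f` and the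
common subfamily `e ∘ δ = f ∘ δ`. -/
structure ProjectionTriple {ι κ : Type*} (P Q R : E →ₗ[ℂ] E) (e f : ι → E) (δ : κ → ι) : Prop where
  symmP : P.IsSymmetric
  symmQ : Q.IsSymmetric
  symmR : R.IsSymmetric
  fixP : ∀ i, P (e i) = e i
  fixQ : ∀ i, Q (f i) = f i
  fixR : ∀ i, R (e (δ i)) = e (δ i)
  rangeP : ∀ x, P x ∈ Submodule.span ℂ (Set.range e)
  rangeQ : ∀ x, Q x ∈ Submodule.span ℂ (Set.range f)
  rangeR : ∀ x, R x ∈ Submodule.span ℂ (Set.range fun i => e (δ i))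
  common : ∀ i, f (δ i) = e (δ i)

namespace ProjectionTriple

variable {ι κ : Type*} {P Q R : E →ₗ[ℂ] E} {e f : ι → E} {δ : κ → ι}

theorem idemP (h : ProjectionTriple P Q R e f δ) (x : E) : P (P x) = P x :=
  apply_eq_self_of_mem_span h.fixP (h.rangeP x)

theorem idemQ (h : ProjectionTriple P Q R e f δ) (x : E) : Q (Q x) = Q x :=
  apply_eq_self_of_mem_span h.fixQ (h.rangeQ x)

theorem idemR (h : ProjectionTriple P Q R e f δ) (x : E) : R (R x) = R x :=
  apply_eq_self_of_mem_span h.fixR (h.rangeR x)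

theorem P_R (h : ProjectionTriple P Q R e f δ) (x : E) : P (R x) = R x :=
  apply_eq_self_of_mem_span (fun i => h.fixP (δ i)) (h.rangeR x)

theorem Q_R (h : ProjectionTriple P Q R e f δ) (x : E) : Q (R x) = R x :=
  apply_eq_self_of_mem_span (fun i => by rw [← h.common, h.fixQ]) (h.rangeR x)

/-- This is the adjoint of `P R = R`. -/
theorem R_P (h : ProjectionTriple P Q R e f δ) (x : E) : R (P x) = R x :=
  ext_inner_left ℂ fun y => by rw [← h.symmR, ← h.symmP, h.P_R, h.symmR]

/-- Both projections fix the range of `R`, so the common part can be removed before projecting; what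
remains is orthogonal to it. -/
theorem apply_eq (h : ProjectionTriple P Q R e f δ) (x : E) :
    Q (P x) - R x = Q (P (x - R x)) := by
  rw [map_sub, map_sub, h.P_R, h.Q_R]

theorem norm_sub_le (h : ProjectionTriple P Q R e f δ) (x : E) : ‖P (x - R x)‖ ≤ ‖x‖ := by
  refine (norm_symm_proj_le h.symmP h.idemP _).trans ?_
  have := norm_symm_proj_le (P := LinearMap.id - R) (LinearMap.IsSymmetric.id.sub h.symmR)
    (fun y => by simp [h.idemR]) x
  simpa using this

theorem norm_apply_le (h : ProjectionTriple P Q R e f δ) (x : E) : ‖Q (P x) - R x‖ ≤ ‖x‖ := by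
  rw [h.apply_eq]
  exact (norm_symm_proj_le h.symmQ h.idemQ _).trans (h.norm_sub_le x)

theorem inner_eq_zero (h : ProjectionTriple P Q R e f δ) {x : E} (hx : R x = 0) (i : κ) :
    ⟪e (δ i), x⟫_ℂ = 0 := by
  rw [← h.fixR, h.symmR, hx, inner_zero_right]

end ProjectionTriple

section Almost

variable {ι : Type*} [Fintype ι] {e : ι → E} {t : ℝ}

/-- The Gram matrix differs from the identity by entries of size at most `t`, so the squared norm of
the combination is at least `(1 - n t) ∑ ‖y i‖² ≥ (3/4) ∑ ‖y i‖²`, with `n` the number of vectors.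
Cauchy–Schwarz supplies the other factor `n`. -/
theorem sum_norm_sq_le (ht : 0 ≤ t) (h1 : ∀ i, ‖e i‖ = 1)
    (h : ∀ i j, i ≠ j → ‖⟪e i, e j⟫_ℂ‖ ≤ t) (hn : Fintype.card ι * t ≤ 1 / 4) (y : ι → ℂ) :
    (∑ i, ‖y i‖) ^ 2 ≤ Fintype.card ι * (4 / 3 * ‖∑ i, y i • e i‖ ^ 2) := by
  classical
  have hcs : (∑ i, ‖y i‖) ^ 2 ≤ Fintype.card ι * ∑ i, ‖y i‖ ^ 2 := by
    simpa using sq_sum_le_card_mul_sum_sq (s := Finset.univ) (f := fun i => ‖y i‖)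
  have hmain : (∑ i, ‖y i‖ ^ 2) - t * (∑ i, ‖y i‖) ^ 2 ≤ ‖∑ i, y i • e i‖ ^ 2 := by
    have hexp : ((‖∑ i, y i • e i‖ ^ 2 : ℝ) : ℂ) - (∑ i, ‖y i‖ ^ 2 : ℝ)
        = ∑ i, ∑ j, if i = j then 0 else star (y i) * (y j * ⟪e i, e j⟫_ℂ) := by
      have h2 : ((‖∑ i, y i • e i‖ ^ 2 : ℝ) : ℂ) = ∑ i, ∑ j, star (y i) * (y j * ⟪e i, e j⟫_ℂ) := by
        have := inner_self_eq_norm_sq_to_K (𝕜 := ℂ) (∑ i, y i • e i)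
        push_cast
        rw [← Complex.coe_algebraMap, ← this, sum_inner]
        refine Finset.sum_congr rfl fun i _ => ?_
        rw [inner_sum]
        refine Finset.sum_congr rfl fun j _ => ?_
        rw [inner_smul_left, inner_smul_right]; rfl
      have h3 : ((∑ i, ‖y i‖ ^ 2 : ℝ) : ℂ)
          = ∑ i, ∑ j, if i = j then star (y i) * (y j * ⟪e i, e j⟫_ℂ) else 0 := by
        push_cast
        refine Finset.sum_congr rfl fun i _ => ?_
        rw [Finset.sum_ite_eq, if_pos (Finset.mem_univ i), inner_self_eq_norm_sq_to_K, h1]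
        simp [Complex.conj_mul']
      rw [h2, h3, ← Finset.sum_sub_distrib]
      refine Finset.sum_congr rfl fun i _ => ?_
      rw [← Finset.sum_sub_distrib]
      refine Finset.sum_congr rfl fun j _ => ?_
      split_ifs <;> simp
    have hb : ‖((‖∑ i, y i • e i‖ ^ 2 : ℝ) : ℂ) - (∑ i, ‖y i‖ ^ 2 : ℝ)‖ ≤ t * (∑ i, ‖y i‖) ^ 2 := by
      rw [hexp, sq, Finset.sum_mul_sum, Finset.mul_sum]
      refine (norm_sum_le _ _).trans (Finset.sum_le_sum fun i _ => ?_)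
      rw [Finset.mul_sum]
      refine (norm_sum_le _ _).trans (Finset.sum_le_sum fun j _ => ?_)
      split_ifs with hij
      · simp; positivity
      · rw [norm_mul, norm_mul, norm_star]
        have := mul_le_mul_of_nonneg_left (h i j hij)
          (mul_nonneg (norm_nonneg (y i)) (norm_nonneg (y j)))
        nlinarith
    rw [← Complex.ofReal_sub, Complex.norm_real, Real.norm_eq_abs] at hb
    linarith [neg_le_of_abs_le hb]
  have hs : t * (∑ i, ‖y i‖) ^ 2 ≤ 1 / 4 * ∑ i, ‖y i‖ ^ 2 := by
    have h0 : 0 ≤ ∑ i, ‖y i‖ ^ 2 := by positivity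
    nlinarith [mul_le_mul_of_nonneg_left hcs ht, mul_le_mul_of_nonneg_right hn h0]
  refine hcs.trans (mul_le_mul_of_nonneg_left ?_ (Nat.cast_nonneg _))
  linarith

/-- Orthogonality to `e i` expresses `y i` through the other coefficients, each weighted by a small
overlap. -/
theorem norm_coeff_le (h1 : ∀ i, ‖e i‖ = 1)
    (h : ∀ i j, i ≠ j → ‖⟪e i, e j⟫_ℂ‖ ≤ t) (ht : 0 ≤ t) (y : ι → ℂ) (i : ι)
    (hi : ⟪e i, ∑ j, y j • e j⟫_ℂ = 0) : ‖y i‖ ≤ t * ∑ j, ‖y j‖ := by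
  classical
  rw [inner_sum, ← Finset.add_sum_erase _ _ (Finset.mem_univ i), inner_smul_right,
    inner_self_eq_norm_sq_to_K, h1] at hi
  have hy : y i = -∑ j ∈ Finset.univ.erase i, ⟪e i, y j • e j⟫_ℂ := by
    rw [eq_neg_iff_add_eq_zero]; simpa only [RCLike.ofReal_one, one_pow, mul_one] using hi
  rw [hy, norm_neg, Finset.mul_sum]
  refine (norm_sum_le _ _).trans ((Finset.sum_le_sum fun j hj => ?_).trans
    (Finset.sum_le_sum_of_subset_of_nonneg (Finset.erase_subset i _)
      fun j _ _ => mul_nonneg ht (norm_nonneg (y j))))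
  rw [inner_smul_right, norm_mul, mul_comm]
  exact mul_le_mul_of_nonneg_right (h i j (Finset.ne_of_mem_erase hj).symm) (norm_nonneg _)

end Almost

/-- Two almost orthonormal families that agree on a common part and are almost orthogonal
elsewhere: the projections onto their spans have a small angle relative to the common part. -/
theorem ProjectionTriple.norm_apply_le_of_almost_orthonormal {ι κ : Type*} [Fintype ι]
    {P Q R : E →ₗ[ℂ] E} {e f : ι → E} {δ : κ → ι} (h : ProjectionTriple P Q R e f δ)
    {t : ℝ} (ht : 0 ≤ t) (hn : Fintype.card ι * t ≤ 1 / 4)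
    (he1 : ∀ i, ‖e i‖ = 1) (hf1 : ∀ i, ‖f i‖ = 1)
    (he : ∀ i j, i ≠ j → ‖⟪e i, e j⟫_ℂ‖ ≤ t) (hf : ∀ i j, i ≠ j → ‖⟪f i, f j⟫_ℂ‖ ≤ t)
    (hef : ∀ i j, ¬ (i = j ∧ i ∈ Set.range δ) → ‖⟪f i, e j⟫_ℂ‖ ≤ t) (x : E) :
    ‖Q (P x) - R x‖ ≤ 8 / 3 * Fintype.card ι * t * ‖x‖ := by
  classical
  rw [h.apply_eq]
  set Y := P (x - R x) with hY
  have hRY : R Y = 0 := by rw [hY, h.R_P, map_sub, h.idemR, sub_self]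
  obtain ⟨y, hy⟩ := (Submodule.mem_span_range_iff_exists_fun ℂ).1 (h.rangeP (x - R x))
  obtain ⟨z, hz⟩ := (Submodule.mem_span_range_iff_exists_fun ℂ).1 (h.rangeQ Y)
  rw [← hY] at hy
  -- Overlaps on the common part are not small, but there the coefficients of `Y` are, since `Y` is
  -- orthogonal to the common vectors.
  have hyD : ∀ i ∈ Set.range δ, ‖y i‖ ≤ t * ∑ j, ‖y j‖ := by
    rintro _ ⟨i, rfl⟩
    exact norm_coeff_le he1 he ht y _ (by rw [hy]; exact h.inner_eq_zero hRY i)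
  have hY0 := norm_nonneg Y
  have hZ0 := norm_nonneg (Q Y)
  have hsy : (∑ i, ‖y i‖) ^ 2 ≤ Fintype.card ι * (4 / 3 * ‖Y‖ ^ 2) := by
    rw [← hy]; exact sum_norm_sq_le ht he1 he hn y
  have hsz : (∑ i, ‖z i‖) ^ 2 ≤ Fintype.card ι * (4 / 3 * ‖Q Y‖ ^ 2) := by
    rw [← hz]; exact sum_norm_sq_le ht hf1 hf hn z
  have hinner : ⟪Q Y, Y⟫_ℂ = ∑ i, ∑ j, star (z i) * (y j * ⟪f i, e j⟫_ℂ) := by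
    rw [← hz, sum_inner]
    refine Finset.sum_congr rfl fun i _ => ?_
    rw [← hy, inner_sum]
    refine Finset.sum_congr rfl fun j _ => ?_
    rw [inner_smul_left, inner_smul_right]; rfl
  have hf1e : ∀ i j, ‖⟪f i, e j⟫_ℂ‖ ≤ 1 := fun i j =>
    (norm_inner_le_norm _ _).trans (by rw [hf1, he1, one_mul])
  -- One factor `t` comes from the small overlaps, the other from the small coefficients at the
  -- common indices.
  have hbound : ‖⟪Q Y, Y⟫_ℂ‖ ≤ 2 * t * ((∑ i, ‖z i‖) * ∑ j, ‖y j‖) := by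
    rw [hinner]
    have hterm : ∀ i j, ‖star (z i) * (y j * ⟪f i, e j⟫_ℂ)‖ ≤
        t * (‖z i‖ * ‖y j‖) + if i = j then ‖z i‖ * (t * ∑ l, ‖y l‖) else 0 := by
      intro i j
      rw [norm_mul, norm_mul, norm_star]
      by_cases hij : i = j ∧ i ∈ Set.range δ
      · obtain ⟨rfl, hi⟩ := hij
        rw [if_pos rfl]
        have h1 := mul_le_mul (hyD i hi) (hf1e i i) (norm_nonneg _)
          ((norm_nonneg _).trans (hyD i hi))
        have h2 := mul_le_mul_of_nonneg_left h1 (norm_nonneg (z i))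
        have : 0 ≤ t * (‖z i‖ * ‖y i‖) := by positivity
        linarith
      · have h1 := mul_le_mul_of_nonneg_left (hef i j hij)
          (mul_nonneg (norm_nonneg (z i)) (norm_nonneg (y j)))
        have h2 : 0 ≤ if i = j then ‖z i‖ * (t * ∑ l, ‖y l‖) else 0 := by
          split_ifs <;> positivity
        linarith
    calc _ ≤ ∑ i, ∑ j, (t * (‖z i‖ * ‖y j‖) + if i = j then ‖z i‖ * (t * ∑ l, ‖y l‖) else 0) :=
          (norm_sum_le _ _).trans (Finset.sum_le_sum fun i _ =>
            (norm_sum_le _ _).trans (Finset.sum_le_sum fun j _ => hterm i j))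
      _ = _ := by
          simp only [Finset.sum_add_distrib, Finset.sum_ite_eq, Finset.mem_univ, if_true]
          simp only [← Finset.mul_sum, ← Finset.sum_mul]
          ring
  have hprod : (∑ i, ‖z i‖) * ∑ j, ‖y j‖ ≤ Fintype.card ι * (4 / 3) * (‖Q Y‖ * ‖Y‖) := by
    refine abs_le_of_sq_le_sq' ?_ (by positivity) |>.2
    have := mul_le_mul hsz hsy (by positivity) (by positivity)
    nlinarith
  have hself : ‖⟪Q Y, Y⟫_ℂ‖ = ‖Q Y‖ * ‖Q Y‖ := by
    rw [← h.idemQ Y, h.symmQ, h.idemQ, inner_self_eq_norm_sq_to_K]; simp [sq]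
  have hfin : ‖Q Y‖ * ‖Q Y‖ ≤ ‖Q Y‖ * (8 / 3 * Fintype.card ι * t * ‖Y‖) := by
    rw [← hself]
    refine hbound.trans ((mul_le_mul_of_nonneg_left hprod (by positivity)).trans (le_of_eq ?_))
    ring
  have hYx : 8 / 3 * Fintype.card ι * t * ‖Y‖ ≤ 8 / 3 * Fintype.card ι * t * ‖x‖ :=
    mul_le_mul_of_nonneg_left (h.norm_sub_le x) (by positivity)
  rcases hZ0.eq_or_lt with h0 | h0
  · rw [← h0]; positivity
  · exact (le_of_mul_le_mul_left hfin h0).trans hYx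

end Projections

end TwirlSwap

namespace TwirlSwap

/-! ### Algebra of tensor powers. -/

section TensorPow

variable {n : Type} {k : ℕ}

theorem tensorPow_apply (U : Matrix n n ℂ) (x y : Fin k → n) :
    tensorPow k U x y = ∏ i, U (x i) (y i) := rfl

theorem tensorPow_conjTranspose (U : Matrix n n ℂ) : tensorPow k Uᴴ = (tensorPow k U)ᴴ := by
  ext x y
  simp [tensorPow_apply, conjTranspose_apply]

theorem tensorPow_mul [Fintype n] (U V : Matrix n n ℂ) :
    tensorPow k (U * V) = tensorPow k U * tensorPow k V := by
  ext x y
  simp only [tensorPow_apply, Matrix.mul_apply, ← Finset.prod_mul_distrib]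
  rw [Finset.prod_univ_sum, Fintype.piFinset_univ]

theorem tensorPow_one [DecidableEq n] : tensorPow k (1 : Matrix n n ℂ) = 1 := by
  ext x y
  simp only [tensorPow_apply, Matrix.one_apply, Finset.prod_ite_zero, Finset.mem_univ, true_imp_iff,
    Finset.prod_const_one, funext_iff]

theorem tensorPow_diagonal [DecidableEq n] (z : n → ℂ) :
    tensorPow k (diagonal z) = diagonal fun x => ∏ i, z (x i) := by
  ext x y
  simp only [tensorPow_apply, diagonal_apply, Finset.prod_ite_zero, Finset.mem_univ, true_imp_iff,
    funext_iff]

variable [Fintype n] [DecidableEq n]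

theorem tensorPow_unitary_mul (U : unitaryGroup n ℂ) :
    tensorPow k (U : Matrix n n ℂ) * (tensorPow k (U : Matrix n n ℂ))ᴴ = 1 := by
  rw [← tensorPow_conjTranspose, ← tensorPow_mul, ← star_eq_conjTranspose,
    mem_unitaryGroup_iff.1 U.2, tensorPow_one]

theorem tensorPow_unitary_mul' (U : unitaryGroup n ℂ) :
    (tensorPow k (U : Matrix n n ℂ))ᴴ * tensorPow k (U : Matrix n n ℂ) = 1 := by
  rw [← tensorPow_conjTranspose, ← tensorPow_mul, ← star_eq_conjTranspose,
    mem_unitaryGroup_iff'.1 U.2, tensorPow_one]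

end TensorPow

/-! ### The twirl as a self-adjoint map into the commutant. -/

section TwirlProperties

variable {n : Type} [Fintype n] [DecidableEq n] {k : ℕ}

theorem linearMap_twirl (L : Matrix (Fin k → n) (Fin k → n) ℂ →ₗ[ℂ] ℂ)
    (X : Matrix (Fin k → n) (Fin k → n) ℂ) :
    L (twirl n k X) = ∫ U : unitaryGroup n ℂ,
      L (tensorPow k (U : Matrix n n ℂ) * X * (tensorPow k (U : Matrix n n ℂ))ᴴ)
        ∂(haarUnitary n) := by
  have hL : ∀ M, L M = ∑ x, ∑ y, M x y * L (Matrix.single x y 1) := by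
    intro M
    conv_lhs => rw [matrix_eq_sum_single M]
    simp only [map_sum]
    refine Finset.sum_congr rfl fun x _ => Finset.sum_congr rfl fun y _ => ?_
    rw [← smul_eq_mul, ← map_smul, smul_single, smul_eq_mul, mul_one]
  rw [hL]
  simp_rw [hL (_ * _ * _)]
  rw [integral_finsetSum]
  · refine Finset.sum_congr rfl fun x _ => ?_
    rw [integral_finsetSum]
    · refine Finset.sum_congr rfl fun y _ => ?_
      rw [integral_mul_const]
      rfl
    · exact fun y _ => (integrable_twirl_entry k X x y).mul_const _
  · exact fun x _ => integrable_finsetSum _ fun y _ =>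
      (integrable_twirl_entry k X x y).mul_const _

theorem twirl_of_commute {X : Matrix (Fin k → n) (Fin k → n) ℂ}
    (h : ∀ U : unitaryGroup n ℂ, tensorPow k (U : Matrix n n ℂ) * X
      = X * tensorPow k (U : Matrix n n ℂ)) : twirl n k X = X := by
  ext x y
  change ∫ U : unitaryGroup n ℂ, _ ∂(haarUnitary n) = _
  simp [h, mul_assoc, tensorPow_unitary_mul]

theorem tensorPow_mul_twirl (X : Matrix (Fin k → n) (Fin k → n) ℂ) (V : unitaryGroup n ℂ) :
    tensorPow k (V : Matrix n n ℂ) * twirl n k X = twirl n k X * tensorPow k (V : Matrix n n ℂ) := by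
  have key : tensorPow k (V : Matrix n n ℂ) * twirl n k X * (tensorPow k (V : Matrix n n ℂ))ᴴ
      = twirl n k X := by
    ext x y
    have h := linearMap_twirl (Matrix.entryLinearMap ℂ ℂ x y ∘ₗ LinearMap.mulLeftRight ℂ
      (tensorPow k (V : Matrix n n ℂ), (tensorPow k (V : Matrix n n ℂ))ᴴ)) X
    simp only [LinearMap.comp_apply, LinearMap.mulLeftRight_apply, entryLinearMap_apply] at h
    rw [h]
    change _ = ∫ U : unitaryGroup n ℂ, _ ∂(haarUnitary n)
    -- Conjugation by `V` only translates the integration variable `U` to `V * U`.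
    refine Eq.trans ?_ (integral_mul_left_eq_self (fun U : unitaryGroup n ℂ =>
      (tensorPow k (U : Matrix n n ℂ) * X * (tensorPow k (U : Matrix n n ℂ))ᴴ) x y) V)
    refine integral_congr_ae (Filter.Eventually.of_forall fun U => ?_)
    simp only [Submonoid.coe_mul, tensorPow_mul, conjTranspose_mul, mul_assoc]
  conv_rhs => rw [← key]
  rw [mul_assoc, tensorPow_unitary_mul', mul_one]

/-- A right translate is again a left-invariant probability measure, so uniqueness of Haar measure
applies. The same argument then gives invariance under inversion. -/
instance isMulRightInvariant_haarUnitary : (haarUnitary n).IsMulRightInvariant := by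
  refine ⟨fun g => ?_⟩
  have := Measure.isProbabilityMeasure_map (μ := haarUnitary n)
    (continuous_mul_const g).measurable.aemeasurable
  have : (Measure.map (· * g) (haarUnitary n)).IsOpenPosMeasure :=
    (continuous_mul_const g).isOpenPosMeasure_map (Group.mulRight_bijective g).surjective
  have : (Measure.map (· * g) (haarUnitary n)).IsHaarMeasure := {}
  exact Measure.isHaarMeasure_eq_of_isProbabilityMeasure _ _

instance isInvInvariant_haarUnitary : (haarUnitary n).IsInvInvariant := by
  have : IsProbabilityMeasure (haarUnitary n).inv := ⟨by simp⟩
  have : (haarUnitary n).inv.IsOpenPosMeasure := ⟨fun U hU hne => by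
    rw [Measure.inv_apply]
    exact hU.inv.measure_ne_zero _ hne.inv⟩
  have : (haarUnitary n).inv.IsHaarMeasure := {}
  exact ⟨Measure.isHaarMeasure_eq_of_isProbabilityMeasure _ _⟩

/-- The Hilbert–Schmidt inner product. -/
def hsInner {a : Type} [Fintype a] (X Y : Matrix a a ℂ) : ℂ := (Xᴴ * Y).trace

theorem hsInner_eq_sum {a : Type} [Fintype a] (X Y : Matrix a a ℂ) :
    hsInner X Y = ∑ x, ∑ y, star (X x y) * Y x y := by
  simp only [hsInner, Matrix.trace, diag_apply, Matrix.mul_apply, conjTranspose_apply]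
  exact Finset.sum_comm

theorem star_hsInner {a : Type} [Fintype a] (X Y : Matrix a a ℂ) :
    star (hsInner X Y) = hsInner Y X := by
  rw [hsInner, ← trace_conjTranspose, conjTranspose_mul, conjTranspose_conjTranspose, hsInner]

theorem hsInner_twirl_right (X Y : Matrix (Fin k → n) (Fin k → n) ℂ) :
    hsInner X (twirl n k Y) = ∫ U : unitaryGroup n ℂ,
      hsInner X (tensorPow k (U : Matrix n n ℂ) * Y * (tensorPow k (U : Matrix n n ℂ))ᴴ)
        ∂(haarUnitary n) :=
  linearMap_twirl (Matrix.traceLinearMap _ ℂ ℂ ∘ₗ LinearMap.mulLeft ℂ Xᴴ) Y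

/-- The adjoint of conjugation by a unitary is conjugation by its inverse, and the Haar measure is
invariant under inversion. -/
theorem hsInner_twirl (X Y : Matrix (Fin k → n) (Fin k → n) ℂ) :
    hsInner (twirl n k X) Y = hsInner X (twirl n k Y) := by
  rw [← star_hsInner, hsInner_twirl_right, hsInner_twirl_right,
    ← integral_inv_eq_self (fun U : unitaryGroup n ℂ => hsInner X _), Complex.star_def, ← integral_conj]
  refine integral_congr_ae (Filter.Eventually.of_forall fun U => ?_)
  simp only [← Complex.star_def]
  rw [star_hsInner]
  have hU : tensorPow k ((U⁻¹ : unitaryGroup n ℂ) : Matrix n n ℂ)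
      = (tensorPow k (U : Matrix n n ℂ))ᴴ := tensorPow_conjTranspose _
  rw [hU, conjTranspose_conjTranspose]
  simp only [hsInner, conjTranspose_mul, conjTranspose_conjTranspose]
  rw [← mul_assoc, mul_assoc, trace_mul_comm, trace_mul_comm Xᴴ]
  simp only [mul_assoc]

end TwirlProperties

/-! ### Schur–Weyl duality: the commutant of the tensor powers. -/

section Commutant

variable {n : Type} {k : ℕ}

theorem eq_comp_iff (σ : Equiv.Perm (Fin k)) (x y : Fin k → n) : x = y ∘ σ ↔ y = x ∘ σ.symm := by
  constructor <;> rintro rfl <;> ext i <;> simp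

variable [DecidableEq n]

/-- The operator on `(ℂⁿ)^{⊗k}` that permutes the tensor factors. -/
def permOp (σ : Equiv.Perm (Fin k)) : Matrix (Fin k → n) (Fin k → n) ℂ :=
  Matrix.of fun x y => if x = y ∘ σ then 1 else 0

theorem permOp_apply (σ : Equiv.Perm (Fin k)) (x y : Fin k → n) :
    permOp σ x y = if x = y ∘ σ then 1 else 0 := rfl

theorem prod_update_one (x : Fin k → n) (a : n) (w : ℂ) :
    ∏ i, Function.update (fun _ => (1 : ℂ)) a w (x i)
      = w ^ (Finset.univ.filter fun i => x i = a).card := by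
  simp only [Function.update_apply]
  rw [Finset.prod_ite]
  simp

/-- If all unimodular diagonal matrices have the same tensor power entry at `x` and `y`, then `x`
and `y` take each value equally often. -/
theorem card_fiber_eq {x y : Fin k → n}
    (h : ∀ z : n → ℂ, (∀ a, ‖z a‖ = 1) → ∏ i, z (x i) = ∏ i, z (y i)) (a : n) :
    (Finset.univ.filter fun i => x i = a).card = (Finset.univ.filter fun i => y i = a).card := by
  -- Fibre sizes lie between `0` and `k`, so a root of unity of order `k + 1` tells them apart.
  have hw := Complex.isPrimitiveRoot_exp (k + 1) k.succ_ne_zero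
  set w := Complex.exp (2 * Real.pi * Complex.I / ((k + 1 : ℕ) : ℂ)) with hwdef
  have hw1 : ‖w‖ = 1 := hw.norm'_eq_one k.succ_ne_zero
  have h1 := h (Function.update (fun _ => 1) a w) fun b => by
    by_cases hb : b = a
    · subst hb; simpa using hw1
    · simp [hb]
  rw [prod_update_one, prod_update_one] at h1
  have hc : ∀ u : Fin k → n, (Finset.univ.filter fun i => u i = a).card < k + 1 := fun u =>
    Nat.lt_succ_of_le ((Finset.card_le_univ _).trans (by simp))
  exact hw.pow_inj (hc x) (hc y) h1

theorem exists_perm_of_card_fiber_eq {x y : Fin k → n} (hy : Function.Injective y)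
    (h : ∀ a, (Finset.univ.filter fun i => x i = a).card = (Finset.univ.filter fun i => y i = a).card) :
    ∃ σ : Equiv.Perm (Fin k), x = y ∘ σ := by
  have hex : ∀ i, ∃ j, y j = x i := by
    intro i
    have hpos : 0 < (Finset.univ.filter fun j => x j = x i).card :=
      Finset.card_pos.2 ⟨i, by simp⟩
    rw [h] at hpos
    obtain ⟨j, hj⟩ := Finset.card_pos.1 hpos
    exact ⟨j, (Finset.mem_filter.1 hj).2⟩
  choose s hs using hex
  have hinj : Function.Injective s := by
    intro i i' hii
    have hx : x i' = x i := by rw [← hs, ← hs, hii]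
    have hle : (Finset.univ.filter fun j => x j = x i).card ≤ 1 := by
      rw [h]
      refine Finset.card_le_one.2 fun p hp r hr => hy ?_
      rw [(Finset.mem_filter.1 hp).2, (Finset.mem_filter.1 hr).2]
    exact Finset.card_le_one.1 hle i (by simp) i' (by simp [hx])
  exact ⟨Equiv.ofBijective s (Finite.injective_iff_bijective.1 hinj), funext fun i => (hs i).symm⟩

variable [Fintype n]

theorem tensorPow_mul_permOp (U : Matrix n n ℂ) (σ : Equiv.Perm (Fin k)) :
    tensorPow k U * permOp σ = permOp σ * tensorPow k U := by
  ext x y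
  simp only [Matrix.mul_apply, permOp_apply, eq_comp_iff σ x, mul_ite, mul_one, mul_zero, ite_mul,
    one_mul, zero_mul, Finset.sum_ite_eq', Finset.mem_univ, if_true]
  simp only [tensorPow_apply, Function.comp_apply]
  rw [← Equiv.prod_comp σ.symm]
  simp

theorem twirl_permOp (σ : Equiv.Perm (Fin k)) : twirl n k (permOp σ) = permOp σ :=
  twirl_of_commute fun U => tensorPow_mul_permOp (U : Matrix n n ℂ) σ

theorem prod_eq_of_card_fiber_eq {x y : Fin k → n}
    (h : ∀ a, (Finset.univ.filter fun i => x i = a).card = (Finset.univ.filter fun i => y i = a).card)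
    (z : n → ℂ) : ∏ i, z (x i) = ∏ i, z (y i) := by
  have hx : ∀ u : Fin k → n, ∏ i, z (u i) = ∏ a, z a ^ (Finset.univ.filter fun i => u i = a).card := by
    intro u
    rw [← Finset.prod_fiberwise Finset.univ u]
    refine Finset.prod_congr rfl fun a _ => ?_
    rw [Finset.prod_congr rfl (g := fun _ => z a), Finset.prod_const]
    intro i hi
    rw [(Finset.mem_filter.1 hi).2]
  rw [hx, hx]
  exact Finset.prod_congr rfl fun a _ => by rw [h]

theorem card_fiber_eq_of_commute_diagonal {C : Matrix (Fin k → n) (Fin k → n) ℂ}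
    (h : ∀ z : n → ℂ, (∀ a, ‖z a‖ = 1) → Commute (tensorPow k (diagonal z)) C) {x y : Fin k → n}
    (hxy : C x y ≠ 0) (a : n) :
    (Finset.univ.filter fun i => x i = a).card = (Finset.univ.filter fun i => y i = a).card := by
  refine card_fiber_eq (fun z hz => ?_) a
  have h1 := congrFun (congrFun (h z hz).eq x) y
  rw [tensorPow_diagonal, diagonal_mul, mul_diagonal, mul_comm] at h1
  exact mul_left_cancel₀ hxy h1

/-- Unimodular diagonals already force `C x y = 0` unless `x` is a rearrangement of `y`; for such
pairs every diagonal matrix has equal tensor power entries at `x` and `y`. -/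
theorem commute_diagonal {C : Matrix (Fin k → n) (Fin k → n) ℂ}
    (h : ∀ z : n → ℂ, (∀ a, ‖z a‖ = 1) → Commute (tensorPow k (diagonal z)) C) (z : n → ℂ) :
    Commute (tensorPow k (diagonal z)) C := by
  ext x y
  rw [tensorPow_diagonal, diagonal_mul, mul_diagonal]
  by_cases hxy : C x y = 0
  · simp [hxy]
  · rw [prod_eq_of_card_fiber_eq (card_fiber_eq_of_commute_diagonal h hxy), mul_comm]

theorem diagonal_mem_unitaryGroup {z : n → ℂ} (hz : ∀ a, ‖z a‖ = 1) :
    diagonal z ∈ unitaryGroup n ℂ := by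
  rw [mem_unitaryGroup_iff, star_eq_conjTranspose, diagonal_conjTranspose, diagonal_mul_diagonal,
    ← diagonal_one]
  congr 1
  ext a
  simp [Complex.mul_conj', hz]

theorem commute_isHermitian {C : Matrix (Fin k → n) (Fin k → n) ℂ}
    (h : ∀ U : unitaryGroup n ℂ, Commute (tensorPow k (U : Matrix n n ℂ)) C) {H : Matrix n n ℂ}
    (hH : H.IsHermitian) : Commute (tensorPow k H) C := by
  rw [hH.spectral_theorem, Unitary.conjStarAlgAut_apply, tensorPow_mul, tensorPow_mul]
  refine ((h _).mul_left (commute_diagonal (fun z hz => h ⟨_, diagonal_mem_unitaryGroup hz⟩) _)).mul_left ?_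
  exact h (star hH.eigenvectorUnitary)

/-- Write `M = A + iB` with `A`, `B` Hermitian. Each entry of the commutator for `A + sB` is a
polynomial in `s` that vanishes for all real `s`, where `A + sB` is Hermitian; hence it vanishes at
`s = i`. -/
theorem commute_tensorPow {C : Matrix (Fin k → n) (Fin k → n) ℂ}
    (h : ∀ U : unitaryGroup n ℂ, Commute (tensorPow k (U : Matrix n n ℂ)) C) (M : Matrix n n ℂ) :
    Commute (tensorPow k M) C := by
  set A : Matrix n n ℂ := (realPart M : Matrix n n ℂ)
  set B : Matrix n n ℂ := (imaginaryPart M : Matrix n n ℂ)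
  have hM : A + Complex.I • B = M := realPart_add_I_smul_imaginaryPart M
  have hA : A.IsHermitian := (realPart M).2
  have hB : B.IsHermitian := (imaginaryPart M).2
  ext x y
  let T : (Fin k → n) → (Fin k → n) → Polynomial ℂ := fun u v =>
    ∏ i, (Polynomial.C (A (u i) (v i)) + Polynomial.X * Polynomial.C (B (u i) (v i)))
  let p : Polynomial ℂ := ∑ z, T x z * Polynomial.C (C z y) - ∑ z, Polynomial.C (C x z) * T z y
  have hT : ∀ s u v, (T u v).eval s = tensorPow k (A + s • B) u v := by
    intro s u v
    simp [T, Polynomial.eval_prod, tensorPow_apply, mul_comm s]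
  have hp : ∀ s, p.eval s = (tensorPow k (A + s • B) * C) x y - (C * tensorPow k (A + s • B)) x y := by
    intro s
    simp [p, Polynomial.eval_finsetSum, hT, Matrix.mul_apply]
  have hp0 : p = 0 := by
    refine Polynomial.eq_zero_of_infinite_isRoot p
      ((Set.infinite_range_of_injective Complex.ofReal_injective).mono ?_)
    rintro _ ⟨s, rfl⟩
    have hs : (A + (s : ℂ) • B).IsHermitian := by
      refine hA.add ?_
      rw [Matrix.IsHermitian, conjTranspose_smul, hB.eq]
      simp
    rw [Set.mem_ofPred_eq, Polynomial.IsRoot, hp, (commute_isHermitian h hs).eq, sub_self]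
  have := hp Complex.I
  rw [hp0, Polynomial.eval_zero, hM] at this
  exact (sub_eq_zero.1 this.symm)

/-- The commutant of the tensor power representation of the unitary group is spanned by the
permutation operators. -/
theorem mem_span_permOp {C : Matrix (Fin k → n) (Fin k → n) ℂ} (hk : k ≤ Fintype.card n)
    (h : ∀ U : unitaryGroup n ℂ, Commute (tensorPow k (U : Matrix n n ℂ)) C) :
    C ∈ Submodule.span ℂ (Set.range (permOp : Equiv.Perm (Fin k) → _)) := by
  obtain ⟨f⟩ : Nonempty (Fin k ↪ n) := Function.Embedding.nonempty_of_card_le (by simpa using hk)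
  -- `C` is determined by its column at an injective label `f`: the matrix `M` below sends the basis
  -- vector `f i` to a sum of basis vectors chosen so that the `(y, f)` entry of its tensor power is
  -- the only nonzero one in column `f` when `M` maps each `f i` to `y i`. Commuting `C` past it
  -- recovers column `y`, and column `f` is supported on the rearrangements `f ∘ σ`.
  have hC : C = ∑ σ : Equiv.Perm (Fin k), C (f ∘ σ) f • permOp σ := by
    ext x y
    let M : Matrix n n ℂ := Matrix.of fun a b => if ∃ i, f i = b ∧ y i = a then 1 else 0
    have hM : ∀ u (σ : Equiv.Perm (Fin k)), tensorPow k M u (f ∘ σ) = if u = y ∘ σ then 1 else 0 := by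
      intro u σ
      simp only [tensorPow_apply, M, Matrix.of_apply, Function.comp_apply, f.injective.eq_iff,
        exists_eq_left, Finset.prod_ite_zero, Finset.mem_univ, true_imp_iff, Finset.prod_const_one]
      refine if_congr ?_ rfl rfl
      simp only [funext_iff, Function.comp_apply, eq_comm]
    have h1 := congrFun (congrFun (commute_tensorPow h M).eq x) f
    have h2 : (C * tensorPow k M) x f = C x y := by
      rw [Matrix.mul_apply, Finset.sum_eq_single y]
      · have : tensorPow k M y f = 1 := (hM y 1).trans (if_pos rfl)
        rw [this, mul_one]
      · intro u _ hu
        have : tensorPow k M u f = 0 := (hM u 1).trans (if_neg hu)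
        rw [this, mul_zero]
      · simp
    rw [← h2, ← h1, Matrix.mul_apply]
    have hsum : ∀ g : (Fin k → n) → ℂ, (∀ z, (∀ σ : Equiv.Perm (Fin k), z ≠ f ∘ σ) → g z = 0) →
        ∑ z, g z = ∑ σ : Equiv.Perm (Fin k), g (f ∘ σ) := by
      intro g hg
      have hinj : Function.Injective fun σ : Equiv.Perm (Fin k) => f ∘ σ := by
        intro σ τ hst
        ext i
        exact congrArg Fin.val (f.injective (congrFun hst i))
      rw [← Finset.sum_image (s := Finset.univ) (f := g) (g := fun σ : Equiv.Perm (Fin k) => f ∘ σ)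
        hinj.injOn]
      refine (Finset.sum_subset (Finset.subset_univ _) fun z _ hz => hg z fun σ hσ => hz ?_).symm
      exact Finset.mem_image.2 ⟨σ, Finset.mem_univ _, hσ.symm⟩
    rw [hsum]
    · rw [Matrix.sum_apply]
      refine Finset.sum_congr rfl fun σ _ => ?_
      rw [hM, Matrix.smul_apply, permOp_apply, smul_eq_mul, mul_comm]
    · intro z hz
      by_cases hz0 : C z f = 0
      · rw [hz0, mul_zero]
      · obtain ⟨σ, hσ⟩ := exists_perm_of_card_fiber_eq f.injective
          (card_fiber_eq_of_commute_diagonal (fun z hz => h ⟨_, diagonal_mem_unitaryGroup hz⟩) hz0)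
        exact absurd hσ (hz σ)
  rw [hC]
  exact Submodule.sum_mem _ fun σ _ => Submodule.smul_mem _ _ (Submodule.subset_span ⟨σ, rfl⟩)

theorem twirl_mem_span (hk : k ≤ Fintype.card n) (X : Matrix (Fin k → n) (Fin k → n) ℂ) :
    twirl n k X ∈ Submodule.span ℂ (Set.range (permOp : Equiv.Perm (Fin k) → _)) :=
  mem_span_permOp hk fun U => tensorPow_mul_twirl X U

end Commutant

end TwirlSwap

namespace TwirlSwap

/-! ### Self-adjointness and range of a tensor product of maps. -/

section SuperTensor

section

variable {a : Type} [Fintype a]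

theorem hsInner_add_left (X X' Y : Matrix a a ℂ) :
    hsInner (X + X') Y = hsInner X Y + hsInner X' Y := by
  simp [hsInner, add_mul]

theorem hsInner_add_right (X Y Y' : Matrix a a ℂ) :
    hsInner X (Y + Y') = hsInner X Y + hsInner X Y' := by
  simp [hsInner, mul_add]

theorem hsInner_smul_left (c : ℂ) (X Y : Matrix a a ℂ) :
    hsInner (c • X) Y = star c * hsInner X Y := by
  simp [hsInner]

theorem hsInner_smul_right (c : ℂ) (X Y : Matrix a a ℂ) :
    hsInner X (c • Y) = c * hsInner X Y := by
  simp [hsInner]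

end

variable {a b : Type} [Fintype a] [Fintype b]

theorem hsInner_kronecker (X X' : Matrix a a ℂ) (Y Y' : Matrix b b ℂ) :
    hsInner (X ⊗ₖ Y) (X' ⊗ₖ Y') = hsInner X X' * hsInner Y Y' := by
  rw [hsInner, conjTranspose_kronecker, ← mul_kronecker_mul, trace_kronecker, hsInner, hsInner]

variable [DecidableEq a] [DecidableEq b]

theorem kronecker_induction {p : Matrix (a × b) (a × b) ℂ → Prop} (zero : p 0)
    (kronecker : ∀ X Y, p (X ⊗ₖ Y)) (add : ∀ M N, p M → p N → p (M + N))
    (M : Matrix (a × b) (a × b) ℂ) : p M := by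
  rw [← (kroneckerEquiv a b).apply_symm_apply M]
  induction (kroneckerEquiv a b).symm M using TensorProduct.induction_on with
  | zero => rwa [map_zero]
  | tmul X Y => rw [kroneckerEquiv_tmul]; exact kronecker X Y
  | add x y hx hy => rw [map_add]; exact add _ _ hx hy

theorem hsInner_superTensor {Φ : Matrix a a ℂ →ₗ[ℂ] Matrix a a ℂ}
    {Ψ : Matrix b b ℂ →ₗ[ℂ] Matrix b b ℂ}
    (hΦ : ∀ X Y, hsInner (Φ X) Y = hsInner X (Φ Y)) (hΨ : ∀ X Y, hsInner (Ψ X) Y = hsInner X (Ψ Y))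
    (M N : Matrix (a × b) (a × b) ℂ) :
    hsInner (superTensor Φ Ψ M) N = hsInner M (superTensor Φ Ψ N) := by
  induction M using kronecker_induction with
  | zero => simp [hsInner]
  | add M M' h h' => rw [map_add, hsInner_add_left, hsInner_add_left, h, h']
  | kronecker X Y =>
    induction N using kronecker_induction with
    | zero => simp [hsInner]
    | add M M' h h' => rw [map_add, hsInner_add_right, hsInner_add_right, h, h']
    | kronecker X' Y' =>
      rw [superTensor_kronecker, superTensor_kronecker, hsInner_kronecker, hsInner_kronecker, hΦ, hΨ]

theorem superTensor_mem_span {ι κ : Type*} {Φ : Matrix a a ℂ →ₗ[ℂ] Matrix a a ℂ}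
    {Ψ : Matrix b b ℂ →ₗ[ℂ] Matrix b b ℂ} {v : ι → Matrix a a ℂ} {w : κ → Matrix b b ℂ}
    (hΦ : ∀ X, Φ X ∈ Submodule.span ℂ (Set.range v))
    (hΨ : ∀ X, Ψ X ∈ Submodule.span ℂ (Set.range w)) (M : Matrix (a × b) (a × b) ℂ) :
    superTensor Φ Ψ M ∈ Submodule.span ℂ (Set.range fun i : ι × κ => v i.1 ⊗ₖ w i.2) := by
  induction M using kronecker_induction with
  | zero => rw [map_zero]; exact zero_mem _
  | add M N hM hN => rw [map_add]; exact add_mem hM hN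
  | kronecker X Y =>
    rw [superTensor_kronecker]
    have h := Submodule.apply_mem_map₂ 
      (kroneckerBilinear : Matrix a a ℂ →ₗ[ℂ] Matrix b b ℂ →ₗ[ℂ] Matrix (a × b) (a × b) ℂ)
      (hΦ X) (hΨ Y)
    rw [Submodule.map₂_span_span] at h
    refine Submodule.span_mono ?_ h
    rintro _ ⟨_, ⟨i, rfl⟩, _, ⟨j, rfl⟩, rfl⟩
    exact ⟨(i, j), rfl⟩

end SuperTensor

/-! ### The maps `P`, `Q`, `R` and the permutation pairs spanning their ranges. -/

section Operators

variable {k q m : ℕ}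

theorem regroup_apply
    (X : Matrix (Fin k → Block q m × Block q m) (Fin k → Block q m × Block q m) ℂ)
    (v w : Full k q m) :
    regroup k q m X v w = X (fun i => (v.1 i, v.2 i)) (fun i => (w.1 i, w.2 i)) := rfl

theorem hsInner_regroup
    (X Y : Matrix (Fin k → Block q m × Block q m) (Fin k → Block q m × Block q m) ℂ) :
    hsInner (regroup k q m X) (regroup k q m Y) = hsInner X Y := by
  rw [hsInner_eq_sum, hsInner_eq_sum]
  let e := (Equiv.arrowProdEquivProdArrow (Fin k) (fun _ => Block q m) (fun _ => Block q m)).symm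
  rw [← Equiv.sum_comp e]
  refine Finset.sum_congr rfl fun v _ => ?_
  rw [← Equiv.sum_comp e]
  rfl

theorem hsInner_R (X Y : Op k q m) : hsInner (R k q m X) Y = hsInner X (R k q m Y) := by
  obtain ⟨X, rfl⟩ := (regroup k q m).surjective X
  obtain ⟨Y, rfl⟩ := (regroup k q m).surjective Y
  simp only [R, LinearMap.comp_apply, LinearEquiv.coe_coe, LinearEquiv.symm_apply_apply]
  rw [hsInner_regroup, hsInner_regroup, hsInner_twirl]

theorem hsInner_P (X Y : Op k q m) : hsInner (P k q m X) Y = hsInner X (P k q m Y) :=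
  hsInner_superTensor hsInner_twirl hsInner_twirl X Y

/-- A pair of permutations of the tensor factors of `A^k` and of `B^k`, as an operator. -/
def permPairOp (p : Equiv.Perm (Fin k) × Equiv.Perm (Fin k)) : Op k q m :=
  permOp p.1 ⊗ₖ permOp p.2

/-- The action of a pair of permutations on basis labels. -/
def permPair (p : Equiv.Perm (Fin k) × Equiv.Perm (Fin k)) (w : Full k q m) : Full k q m :=
  (w.1 ∘ p.1, w.2 ∘ p.2)

theorem permPairOp_apply (p : Equiv.Perm (Fin k) × Equiv.Perm (Fin k)) (v w : Full k q m) :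
    permPairOp p v w = if v = permPair p w then 1 else 0 := by
  rw [permPairOp, kroneckerMap_apply, permOp_apply, permOp_apply, ite_zero_mul_ite_zero, mul_one]
  refine if_congr ?_ rfl rfl
  rw [Prod.ext_iff]
  rfl

theorem regroup_permOp (σ : Equiv.Perm (Fin k)) :
    regroup k q m (permOp σ) = permPairOp (σ, σ) := by
  ext v w
  rw [regroup_apply, permPairOp_apply, permOp_apply]
  refine if_congr ?_ rfl rfl
  simp only [permPair, Prod.ext_iff, funext_iff, Function.comp_apply, forall_and]

theorem P_permPairOp (p : Equiv.Perm (Fin k) × Equiv.Perm (Fin k)) :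
    P k q m (permPairOp p) = permPairOp p := by
  rw [P, permPairOp, superTensor_kronecker, twirl_permOp, twirl_permOp]

theorem R_permPairOp (σ : Equiv.Perm (Fin k)) :
    R k q m (permPairOp (σ, σ)) = permPairOp (σ, σ) := by
  rw [← regroup_permOp]
  simp only [R, LinearMap.comp_apply, LinearEquiv.coe_coe, LinearEquiv.symm_apply_apply,
    twirl_permOp]

theorem P_mem_span (hk : k ≤ q ^ m) (X : Op k q m) :
    P k q m X ∈ Submodule.span ℂ (Set.range permPairOp) :=
  superTensor_mem_span (twirl_mem_span (by simpa using hk)) (twirl_mem_span (by simpa using hk)) X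

theorem R_mem_span (hk : k ≤ q ^ m) (X : Op k q m) :
    R k q m X ∈ Submodule.span ℂ
      (Set.range fun σ : Equiv.Perm (Fin k) => permPairOp (σ, σ)) := by
  have hk2 : k ≤ Fintype.card (Block q m × Block q m) := by
    simp only [Fintype.card_prod, Fintype.card_fun, Fintype.card_fin]
    exact hk.trans (Nat.le_mul_self _)
  have h := Submodule.mem_map_of_mem (f := (regroup k q m).toLinearMap)
    (twirl_mem_span hk2 ((regroup k q m).symm X))
  rw [Submodule.map_span, ← Set.range_comp] at h
  refine Submodule.span_mono ?_ h
  rintro _ ⟨σ, rfl⟩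
  exact ⟨σ, (regroup_permOp σ).symm⟩

/-- The exchange of the first `ℓ` qudits of each `A_i` and `B_i`, on basis labels. -/
def swapLabels (ℓ : ℕ) (w : Full k q m) : Full k q m :=
  (fun i j => if j.val < ℓ then w.2 i j else w.1 i j,
    fun i j => if j.val < ℓ then w.1 i j else w.2 i j)

theorem swapLabels_involutive (ℓ : ℕ) :
    Function.Involutive (swapLabels ℓ : Full k q m → Full k q m) := by
  intro w
  ext i j <;> simp only [swapLabels] <;> split_ifs <;> rfl

theorem swapLabels_zero (w : Full k q m) : swapLabels 0 w = w := by
  ext i j <;> simp [swapLabels]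

theorem regroup_swapOp_apply (ℓ : ℕ) (v w : Full k q m) :
    regroup k q m (tensorPow k (swapOp q m ℓ)) v w = if v = swapLabels ℓ w then 1 else 0 := by
  rw [regroup_apply, tensorPow_apply]
  simp only [swapOp, Matrix.of_apply, Finset.prod_ite_zero, Finset.mem_univ, true_imp_iff,
    Finset.prod_const_one]
  refine if_congr ?_ rfl rfl
  simp only [swapFirst, swapLabels, Prod.ext_iff, funext_iff, forall_and]

theorem SWAP_apply (ℓ : ℕ) (X : Op k q m) :
    SWAP k q m ℓ X = X.submatrix (swapLabels ℓ) (swapLabels ℓ) := by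
  ext v w
  have hs : ∀ u u' : Full k q m, u = swapLabels ℓ u' ↔ u' = swapLabels ℓ u := fun u u' =>
    ⟨fun h => by rw [h, swapLabels_involutive], fun h => by rw [h, swapLabels_involutive]⟩
  rw [SWAP, LinearMap.mulLeftRight_apply, submatrix_apply, Matrix.mul_apply,
    Finset.sum_eq_single (swapLabels ℓ w), Matrix.mul_apply, Finset.sum_eq_single (swapLabels ℓ v),
    regroup_swapOp_apply, regroup_swapOp_apply, swapLabels_involutive, if_pos rfl, if_pos rfl,
    one_mul, mul_one]
  · intro u _ hu
    rw [regroup_swapOp_apply, if_neg (fun h => hu ((hs _ _).1 h)), zero_mul]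
  · simp
  · intro u _ hu
    rw [regroup_swapOp_apply, if_neg hu, mul_zero]
  · simp

theorem SWAP_SWAP (ℓ : ℕ) (X : Op k q m) : SWAP k q m ℓ (SWAP k q m ℓ X) = X := by
  rw [SWAP_apply, SWAP_apply, submatrix_submatrix, (swapLabels_involutive ℓ).comp_self,
    submatrix_id_id]

theorem hsInner_SWAP (ℓ : ℕ) (X Y : Op k q m) :
    hsInner (SWAP k q m ℓ X) (SWAP k q m ℓ Y) = hsInner X Y := by
  rw [SWAP_apply, SWAP_apply, hsInner_eq_sum, hsInner_eq_sum,
    ← Equiv.sum_comp (swapLabels_involutive ℓ).toPerm]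
  refine Finset.sum_congr rfl fun v _ => ?_
  rw [← Equiv.sum_comp (swapLabels_involutive ℓ).toPerm]
  simp [swapLabels_involutive ℓ _]

theorem hsInner_Q (ℓ : ℕ) (X Y : Op k q m) :
    hsInner (Q k q m ℓ X) Y = hsInner X (Q k q m ℓ Y) := by
  simp only [Q, LinearMap.comp_apply]
  rw [← hsInner_SWAP ℓ _ Y, ← hsInner_SWAP ℓ X, SWAP_SWAP, SWAP_SWAP, hsInner_P]

theorem Q_SWAP (ℓ : ℕ) (p : Equiv.Perm (Fin k) × Equiv.Perm (Fin k)) :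
    Q k q m ℓ (SWAP k q m ℓ (permPairOp p)) = SWAP k q m ℓ (permPairOp p) := by
  simp only [Q, LinearMap.comp_apply, SWAP_SWAP, P_permPairOp]

theorem Q_mem_span (ℓ : ℕ) (hk : k ≤ q ^ m) (X : Op k q m) :
    Q k q m ℓ X ∈ Submodule.span ℂ (Set.range fun p => SWAP k q m ℓ (permPairOp p)) := by
  have h := Submodule.mem_map_of_mem (f := SWAP k q m ℓ) (P_mem_span hk (SWAP k q m ℓ X))
  rwa [Submodule.map_span, ← Set.range_comp] at h

/-- Permuting the copies of `A` and `B` simultaneously commutes with an exchange made inside each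
copy. -/
theorem SWAP_permPairOp_diag (ℓ : ℕ) (σ : Equiv.Perm (Fin k)) :
    SWAP k q m ℓ (permPairOp (σ, σ)) = permPairOp (σ, σ) := by
  ext v w
  rw [SWAP_apply, submatrix_apply, permPairOp_apply, permPairOp_apply]
  refine if_congr ?_ rfl rfl
  have : permPair (σ, σ) (swapLabels ℓ w) = swapLabels ℓ (permPair (σ, σ) w) := rfl
  rw [this, (swapLabels_involutive ℓ).injective.eq_iff]

end Operators

/-! ### Overlaps of permutation pairs as counts of basis labels. -/

section Counting

variable {k q m : ℕ}

/-- The number of colourings that two permutations of the positions move to the same colouring. -/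
def agreeCount (q : ℕ) (π σ : Equiv.Perm (Fin k)) : ℕ :=
  Fintype.card {f : Fin k → Fin q // f ∘ π = f ∘ σ}

/-- If `π i ≠ σ i`, the colour at `π i` is forced by the colour at `σ i`, which loses a factor `q`.
The injection below overwrites that redundant colour. -/
theorem agreeCount_mul_le (q : ℕ) (π σ : Equiv.Perm (Fin k)) :
    agreeCount q π σ * q ^ (if π = σ then 0 else 1) ≤ q ^ k := by
  have hcard : Fintype.card (Fin k → Fin q) = q ^ k := by simp
  split_ifs with h
  · rw [pow_zero, mul_one, ← hcard]
    exact Fintype.card_subtype_le _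
  · obtain ⟨i, hi⟩ : ∃ i, π i ≠ σ i := by
      by_contra! hne
      exact h (Equiv.ext hne)
    rw [pow_one, ← hcard, agreeCount]
    conv_lhs => rw [← Fintype.card_fin q, ← Fintype.card_prod]
    rw [Fintype.card_fin]
    refine Fintype.card_le_of_injective
      (fun u : {f : Fin k → Fin q // f ∘ π = f ∘ σ} × Fin q =>
        Function.update u.1.1 (π i) u.2) ?_
    rintro ⟨⟨f, hf⟩, c⟩ ⟨⟨g, hg⟩, d⟩ hfg
    simp only at hfg
    have hne : ∀ j, j ≠ π i → f j = g j := fun j hj => by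
      have := congrFun hfg j
      rwa [Function.update_of_ne hj, Function.update_of_ne hj] at this
    have hcd : c = d := by
      have := congrFun hfg (π i)
      rwa [Function.update_self, Function.update_self] at this
    have hfi : f (π i) = g (π i) := by
      have h1 := congrFun hf i
      have h2 := congrFun hg i
      simp only [Function.comp_apply] at h1 h2
      rw [h1, h2]
      exact hne _ hi.symm
    have : f = g := funext fun j => by
      by_cases hj : j = π i
      · rw [hj, hfi]
      · exact hne j hj
    simp [this, hcd]

/-- The number of basis labels on which the swapped pair `p` and the pair `r` of permutations
agree. -/
def swapCount (q m ℓ : ℕ) (p r : Equiv.Perm (Fin k) × Equiv.Perm (Fin k)) : ℕ :=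
  Fintype.card {w : Full k q m // swapLabels ℓ (permPair r w) = permPair p (swapLabels ℓ w)}

theorem hsInner_SWAP_permPairOp (ℓ : ℕ) (p r : Equiv.Perm (Fin k) × Equiv.Perm (Fin k)) :
    hsInner (SWAP k q m ℓ (permPairOp p)) (permPairOp r) = swapCount q m ℓ p r := by
  rw [hsInner_eq_sum, Finset.sum_comm, swapCount, Fintype.card_subtype, Finset.card_filter,
    Nat.cast_sum]
  refine Finset.sum_congr rfl fun w _ => ?_
  rw [Finset.sum_eq_single (permPair r w)]
  · rw [SWAP_apply, submatrix_apply, permPairOp_apply, permPairOp_apply, if_pos rfl]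
    split_ifs <;> simp
  · intro v _ hv
    rw [permPairOp_apply r, if_neg hv, mul_zero]
  · simp

/-- The equations decouple over the qudit index `j`; for the swapped qudits the two components of
`p` exchange roles. -/
theorem swapCount_eq_prod (q m ℓ : ℕ) (p r : Equiv.Perm (Fin k) × Equiv.Perm (Fin k)) :
    swapCount q m ℓ p r = ∏ j : Fin m, if j.val < ℓ
      then agreeCount q r.1 p.2 * agreeCount q r.2 p.1
      else agreeCount q r.1 p.1 * agreeCount q r.2 p.2 := by
  let C : Fin m → (Fin k → Fin q) × (Fin k → Fin q) → Prop := fun j u =>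
    if j.val < ℓ then u.1 ∘ r.1 = u.1 ∘ p.2 ∧ u.2 ∘ r.2 = u.2 ∘ p.1
    else u.1 ∘ r.1 = u.1 ∘ p.1 ∧ u.2 ∘ r.2 = u.2 ∘ p.2
  classical
  let e : Full k q m ≃ (Fin m → (Fin k → Fin q) × (Fin k → Fin q)) :=
    { toFun := fun w j => (fun i => w.1 i j, fun i => w.2 i j)
      invFun := fun u => (fun i j => (u j).1 i, fun i j => (u j).2 i)
      left_inv := fun _ => rfl
      right_inv := fun _ => rfl }
  have h1 : swapCount q m ℓ p r = Fintype.card ((j : Fin m) → {u // C j u}) := by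
    refine Fintype.card_congr ((e.subtypeEquiv (q := fun u => ∀ j, C j (u j)) fun w => ?_).trans
      (Equiv.subtypePiEquivPi (p := C)))
    simp only [swapLabels, permPair, Prod.ext_iff, funext_iff, Function.comp_apply, C, e,
      Equiv.coe_fn_mk]
    constructor
    · rintro ⟨h1, h2⟩ j
      split_ifs with hj
      · exact ⟨fun i => by simpa [hj] using h2 i j, fun i => by simpa [hj] using h1 i j⟩
      · exact ⟨fun i => by simpa [hj] using h1 i j, fun i => by simpa [hj] using h2 i j⟩
    · intro h
      refine ⟨fun i j => ?_, fun i j => ?_⟩ <;> have hj := h j <;> split_ifs at hj ⊢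
      exacts [hj.2 i, hj.1 i, hj.1 i, hj.2 i]
  rw [h1, Fintype.card_pi]
  refine Finset.prod_congr rfl fun j _ => ?_
  have hprod : ∀ π σ π' σ' : Equiv.Perm (Fin k),
      Fintype.card {u : (Fin k → Fin q) × (Fin k → Fin q) // u.1 ∘ π = u.1 ∘ σ ∧ u.2 ∘ π' = u.2 ∘ σ'}
        = agreeCount q π σ * agreeCount q π' σ' := by
    intro π σ π' σ'
    rw [agreeCount, agreeCount, ← Fintype.card_prod]
    exact Fintype.card_congr
      (Equiv.subtypeProdEquivProd (p := fun f : Fin k → Fin q => f ∘ π = f ∘ σ)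
        (q := fun f : Fin k → Fin q => f ∘ π' = f ∘ σ'))
  split_ifs with hj
  · rw [← hprod]
    exact Fintype.card_congr (Equiv.subtypeEquivRight fun u => by simp [C, hj])
  · rw [← hprod]
    exact Fintype.card_congr (Equiv.subtypeEquivRight fun u => by simp [C, hj])

theorem swapCount_mul_le {ℓ : ℕ} (hℓ : ℓ ≤ m) (p r : Equiv.Perm (Fin k) × Equiv.Perm (Fin k)) :
    swapCount q m ℓ p r * q ^
      (ℓ * ((if r.1 = p.2 then 0 else 1) + if r.2 = p.1 then 0 else 1) +
        (m - ℓ) * ((if r.1 = p.1 then 0 else 1) + if r.2 = p.2 then 0 else 1)) ≤ q ^ (2 * (m * k)) := by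
  have hpair : ∀ π σ π' σ' : Equiv.Perm (Fin k), agreeCount q π σ * agreeCount q π' σ' *
      q ^ ((if π = σ then 0 else 1) + if π' = σ' then 0 else 1) ≤ q ^ (2 * k) := by
    intro π σ π' σ'
    rw [pow_add, mul_mul_mul_comm, two_mul, pow_add]
    exact Nat.mul_le_mul (agreeCount_mul_le q π σ) (agreeCount_mul_le q π' σ')
  have hA := hpair r.1 p.2 r.2 p.1
  have hB := hpair r.1 p.1 r.2 p.2
  have hc : (Finset.univ.filter fun j : Fin m => j.val < ℓ).card = ℓ := by
    rw [Fin.card_filter_val_lt, min_eq_right hℓ]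
  have hc' : (Finset.univ.filter fun j : Fin m => ¬ j.val < ℓ).card = m - ℓ := by
    have := Finset.card_filter_add_card_filter_not (s := (Finset.univ : Finset (Fin m)))
      (fun j : Fin m => j.val < ℓ)
    rw [hc, Finset.card_univ, Fintype.card_fin] at this
    omega
  rw [swapCount_eq_prod, Finset.prod_ite, Finset.prod_const, Finset.prod_const, hc, hc', pow_add,
    mul_mul_mul_comm, mul_comm ℓ, mul_comm (m - ℓ), pow_mul, pow_mul, ← mul_pow, ← mul_pow]
  refine (Nat.mul_le_mul (Nat.pow_le_pow_left hA ℓ) (Nat.pow_le_pow_left hB (m - ℓ))).trans ?_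
  rw [← pow_add, Nat.add_sub_cancel' hℓ, ← pow_mul]
  exact le_of_eq (by ring)

/-- The exponent in `swapCount_mul_le` is at least `2ℓ`. If `p = r` is not diagonal, both swapped
comparisons fail, giving `2ℓ`. If `p ≠ r`, either both unswapped comparisons fail, giving `2(m - ℓ)
≥ 2ℓ`, or exactly one does; then some swapped comparison fails too, giving at least `m`. -/
theorem swapCount_le {ℓ : ℕ} (hq : 1 ≤ q) (hℓ : 2 * ℓ ≤ m)
    {p r : Equiv.Perm (Fin k) × Equiv.Perm (Fin k)} (h : ¬ (p = r ∧ p.1 = p.2)) :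
    swapCount q m ℓ p r * q ^ (2 * ℓ) ≤ q ^ (2 * (m * k)) := by
  refine le_trans (Nat.mul_le_mul_left _ (Nat.pow_le_pow_right hq ?_))
    (swapCount_mul_le (by omega) p r)
  obtain ⟨π, σ⟩ := p
  obtain ⟨π', σ'⟩ := r
  simp only [Prod.mk.injEq] at h ⊢
  have hml : ℓ ≤ m - ℓ := by omega
  split_ifs <;> first | omega | (exfalso; grind)

/-- With no swapped qudits this bounds the overlaps within one family: a differing component costs
`q ^ m`, and `2ℓ ≤ m`. -/
theorem swapCount_zero_le {ℓ : ℕ} (hq : 1 ≤ q) (hℓ : 2 * ℓ ≤ m)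
    {p r : Equiv.Perm (Fin k) × Equiv.Perm (Fin k)} (h : p ≠ r) :
    swapCount q m 0 p r * q ^ (2 * ℓ) ≤ q ^ (2 * (m * k)) := by
  refine le_trans (Nat.mul_le_mul_left _ (Nat.pow_le_pow_right hq ?_))
    (swapCount_mul_le (Nat.zero_le m) p r)
  obtain ⟨π, σ⟩ := p
  obtain ⟨π', σ'⟩ := r
  simp only [ne_eq, Prod.mk.injEq] at h ⊢
  split_ifs <;> first | omega | (exfalso; grind)

theorem SWAP_zero (X : Op k q m) : SWAP k q m 0 X = X := by
  ext v w
  rw [SWAP_apply, submatrix_apply, swapLabels_zero, swapLabels_zero]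

theorem swapCount_self (p : Equiv.Perm (Fin k) × Equiv.Perm (Fin k)) :
    swapCount q m 0 p p = q ^ (2 * (m * k)) := by
  have : swapCount q m 0 p p = Fintype.card (Full k q m) :=
    Fintype.card_congr (Equiv.subtypeUnivEquiv fun w => by rw [swapLabels_zero, swapLabels_zero])
  rw [this]
  simp only [Fintype.card_prod, Fintype.card_fun, Fintype.card_fin, ← pow_mul, ← pow_add, two_mul]

end Counting

end TwirlSwap

namespace TwirlSwap

/-! ### The Hilbert–Schmidt space and the bounds on the angle. -/

section HilbertSchmidt

open scoped ComplexOrder in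
/-- The Hilbert–Schmidt inner product space of operators. -/
@[reducible] noncomputable def hsCore (a : Type) [Fintype a] : InnerProductSpace.Core ℂ (Matrix a a ℂ) where
  inner := hsInner
  conj_inner_symm X Y := star_hsInner Y X
  re_inner_nonneg X := by
    simp only [hsInner_eq_sum, Complex.star_def, Complex.conj_mul', map_sum]
    refine Finset.sum_nonneg fun x _ => Finset.sum_nonneg fun y _ => ?_
    rw [← Complex.ofReal_pow]
    exact sq_nonneg _
  add_left := hsInner_add_left
  smul_left X Y c := hsInner_smul_left c X Y
  definite X h := trace_conjTranspose_mul_self_eq_zero_iff.1 h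

/-- The Hilbert–Schmidt norm. -/
@[reducible] noncomputable def hsNormedAddCommGroup (a : Type) [Fintype a] : NormedAddCommGroup (Matrix a a ℂ) :=
  (hsCore a).toNormedAddCommGroup

attribute [local instance] hsNormedAddCommGroup

/-- The Hilbert–Schmidt inner product, compatible with the Hilbert–Schmidt norm. -/
@[reducible] noncomputable def hsInnerProductSpace (a : Type) [Fintype a] :
    InnerProductSpace ℂ (Matrix a a ℂ) :=
  InnerProductSpace.ofCore (hsCore a).toCore

attribute [local instance] hsInnerProductSpace

theorem inner_eq_hsInner {a : Type} [Fintype a] (X Y : Matrix a a ℂ) :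
    inner ℂ X Y = hsInner X Y := rfl

theorem norm_eq_hsNorm {a : Type} [Fintype a] (X : Matrix a a ℂ) : ‖X‖ = hsNorm X := rfl

variable {k q m : ℕ}

/-- The normalisation of a pair of permutation operators. -/
noncomputable def permPairScale (k q m : ℕ) : ℂ := (((q : ℝ) ^ (m * k))⁻¹ : ℝ)

theorem permPairScale_ne_zero (hq : 1 ≤ q) : permPairScale k q m ≠ 0 := by
  rw [permPairScale, Complex.ofReal_ne_zero]
  have : (0 : ℝ) < q := by exact_mod_cast hq
  positivity

theorem span_smul_range {E ι : Type*} [AddCommGroup E] [Module ℂ E] {c : ℂ} (hc : c ≠ 0)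
    (v : ι → E) :
    Submodule.span ℂ (Set.range fun i => c • v i) = Submodule.span ℂ (Set.range v) := by
  rw [Set.range_smul, Submodule.span_smul_eq_of_isUnit _ _ hc.isUnit]

theorem projectionTriple (ℓ : ℕ) (hq : 1 ≤ q) (hk : k ≤ q ^ m) :
    ProjectionTriple (P k q m) (Q k q m ℓ) (R k q m)
      (fun p => permPairScale k q m • permPairOp p)
      (fun p => permPairScale k q m • SWAP k q m ℓ (permPairOp p))
      (fun σ : Equiv.Perm (Fin k) => (σ, σ)) where
  symmP := hsInner_P
  symmQ := hsInner_Q ℓ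
  symmR := hsInner_R
  fixP p := by rw [map_smul, P_permPairOp]
  fixQ p := by rw [map_smul, Q_SWAP]
  fixR σ := by rw [map_smul, R_permPairOp]
  rangeP X := by
    rw [span_smul_range (permPairScale_ne_zero hq)]; exact P_mem_span hk X
  rangeQ X := by
    rw [span_smul_range (permPairScale_ne_zero hq)]; exact Q_mem_span ℓ hk X
  rangeR X := by
    rw [span_smul_range (permPairScale_ne_zero hq)]; exact R_mem_span hk X
  common σ := by rw [SWAP_permPairOp_diag]

theorem inner_smul_permPairOp (ℓ : ℕ) (p r : Equiv.Perm (Fin k) × Equiv.Perm (Fin k)) :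
    inner ℂ (permPairScale k q m • SWAP k q m ℓ (permPairOp p)) (permPairScale k q m • permPairOp r)
      = ((swapCount q m ℓ p r / (q : ℝ) ^ (2 * (m * k)) : ℝ) : ℂ) := by
  rw [inner_eq_hsInner, hsInner_smul_left, hsInner_smul_right, hsInner_SWAP_permPairOp,
    permPairScale, Complex.star_def, Complex.conj_ofReal, ← Complex.ofReal_natCast,
    ← Complex.ofReal_mul, ← Complex.ofReal_mul, two_mul, pow_add]
  congr 1
  rw [div_eq_mul_inv, mul_inv]
  ring

theorem norm_inner_le {ℓ : ℕ} (hq : 1 ≤ q) {l : ℕ} {p r : Equiv.Perm (Fin k) × Equiv.Perm (Fin k)}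
    (h : swapCount q m l p r * q ^ (2 * ℓ) ≤ q ^ (2 * (m * k))) :
    ‖(inner ℂ (permPairScale k q m • SWAP k q m l (permPairOp p))
      (permPairScale k q m • permPairOp r) : ℂ)‖ ≤ ((q : ℝ) ^ (2 * ℓ))⁻¹ := by
  have hq0 : (0 : ℝ) < q := by exact_mod_cast hq
  rw [inner_smul_permPairOp, Complex.norm_real, Real.norm_of_nonneg (by positivity),
    div_le_iff₀ (by positivity), ← div_eq_inv_mul, le_div_iff₀ (by positivity)]
  exact_mod_cast h

theorem norm_smul_permPairOp (hq : 1 ≤ q) (p : Equiv.Perm (Fin k) × Equiv.Perm (Fin k)) :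
    ‖permPairScale k q m • (permPairOp p : Op k q m)‖ = 1 := by
  have hq0 : (0 : ℝ) < q := by exact_mod_cast hq
  have h := inner_smul_permPairOp (q := q) (m := m) 0 p p
  rw [SWAP_zero, swapCount_self, inner_self_eq_norm_sq_to_K, Nat.cast_pow,
    div_self (by positivity)] at h
  have h1 : ‖permPairScale k q m • (permPairOp p : Op k q m)‖ ^ 2 = 1 :=
    Complex.ofReal_injective (by rw [Complex.ofReal_pow]; exact h)
  exact (pow_eq_one_iff_of_nonneg (norm_nonneg _) two_ne_zero).1 h1

theorem inner_smul_SWAP (ℓ : ℕ) (c : ℂ) (X Y : Op k q m) :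
    inner ℂ (c • SWAP k q m ℓ X) (c • SWAP k q m ℓ Y) = inner ℂ (c • X) (c • Y) := by
  rw [← map_smul, ← map_smul]
  exact hsInner_SWAP ℓ _ _

theorem hsNorm_apply_le (ℓ : ℕ) (hq : 1 ≤ q) (hk : k ≤ q ^ m) (X : Op k q m) :
    hsNorm ((Q k q m ℓ ∘ₗ P k q m - R k q m) X) ≤ hsNorm X :=
  (projectionTriple ℓ hq hk).norm_apply_le X

theorem hsNorm_apply_le_of_small {ℓ : ℕ} (hq : 1 ≤ q) (hℓ : 2 * ℓ ≤ m) (hk : k ≤ q ^ m)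
    (hN : (k.factorial : ℝ) ^ 2 * ((q : ℝ) ^ (2 * ℓ))⁻¹ ≤ 1 / 4) (X : Op k q m) :
    hsNorm ((Q k q m ℓ ∘ₗ P k q m - R k q m) X)
      ≤ 8 / 3 * (k.factorial : ℝ) ^ 2 * ((q : ℝ) ^ (2 * ℓ))⁻¹ * hsNorm X := by
  have hcard : (Fintype.card (Equiv.Perm (Fin k) × Equiv.Perm (Fin k)) : ℝ)
      = (k.factorial : ℝ) ^ 2 := by
    simp [Fintype.card_perm, sq]
  have he : ∀ p r : Equiv.Perm (Fin k) × Equiv.Perm (Fin k), p ≠ r →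
      ‖(inner ℂ (permPairScale k q m • (permPairOp p : Op k q m))
        (permPairScale k q m • permPairOp r) : ℂ)‖ ≤ ((q : ℝ) ^ (2 * ℓ))⁻¹ := by
    intro p r hpr
    have h := norm_inner_le (ℓ := ℓ) hq (swapCount_zero_le hq hℓ hpr)
    rwa [SWAP_zero] at h
  have h := (projectionTriple (m := m) ℓ hq hk).norm_apply_le_of_almost_orthonormal
    (t := ((q : ℝ) ^ (2 * ℓ))⁻¹) (by positivity) (by rwa [hcard])
    (norm_smul_permPairOp hq)
    (fun p => by
      have h1 := norm_smul_permPairOp (m := m) hq p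
      rw [norm_eq_sqrt_re_inner (𝕜 := ℂ)] at h1 ⊢
      rwa [inner_smul_SWAP])
    he (fun p r hpr => by rw [inner_smul_SWAP]; exact he p r hpr)
    (fun p r hpr => norm_inner_le hq (swapCount_le hq hℓ fun hh => hpr
      ⟨hh.1, p.1, Prod.ext rfl hh.2⟩)) X
  rwa [hcard] at h

theorem subspaceAngle_le {ℓ : ℕ} {c : ℝ} (hc : 0 ≤ c)
    (h : ∀ X : Op k q m, hsNorm ((Q k q m ℓ ∘ₗ P k q m - R k q m) X) ≤ c * hsNorm X) :
    subspaceAngle k q m ℓ ≤ c := by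
  refine Real.sSup_le ?_ hc
  rintro _ ⟨X, hX, rfl⟩
  have hX0 : 0 < hsNorm X := by
    rw [← norm_eq_hsNorm]
    exact norm_pos_iff.2 hX
  exact (div_le_iff₀ hX0).2 (h X)

end HilbertSchmidt

/-! ### Numerical estimates and the conclusion. -/

/-- For `k² > 2d` and `k ≤ d` the bound is trivial. -/
theorem one_le_bound_of_large {k d x N : ℝ} (hd : 0 < d) (hk2 : 2 ≤ k) (hkd : k ≤ d)
    (hx : x = k ^ 2 / (2 * d)) (hx1 : 1 < x) (hN : k * (k - 1) ≤ N) :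
    1 ≤ 4 * (((1 - x) ^ 2)⁻¹) ^ 2 * N ^ 3 * d⁻¹ := by
  have hpos : 0 < (x - 1) ^ 4 := pow_pos (by linarith) 4
  have h1 : (x - 1) ^ 4 ≤ x ^ 4 := pow_le_pow_left₀ (by linarith) (by linarith) 4
  have hN1 : k ^ 2 / 2 ≤ N := by nlinarith
  have hN3 : (k ^ 2 / 2) ^ 3 ≤ N ^ 3 := pow_le_pow_left₀ (by positivity) hN1 3
  have hxd : x * d = k ^ 2 / 2 := by rw [hx]; field_simp
  -- Since `k ≤ d` gives `x ≤ k / 2`, the left side is at most `k⁵ / 16`, while `N ≥ k² / 2` makes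
  -- the right side at least `k⁶ / 2`.
  have hkey : x ^ 4 * d ≤ 4 * N ^ 3 := by
    have hxk : x ≤ k / 2 := by
      rw [hx, div_le_div_iff₀ (by positivity) (by norm_num)]
      nlinarith
    have h2 : x ^ 4 * d = x ^ 3 * (k ^ 2 / 2) := by rw [← hxd]; ring
    have h3 : x ^ 3 ≤ (k / 2) ^ 3 := pow_le_pow_left₀ (by linarith) hxk 3
    rw [h2]
    have h4 : x ^ 3 * (k ^ 2 / 2) ≤ (k / 2) ^ 3 * (k ^ 2 / 2) :=
      mul_le_mul_of_nonneg_right h3 (by positivity)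
    have h5 : (k / 2) ^ 3 * (k ^ 2 / 2) ≤ 4 * (k ^ 2 / 2) ^ 3 := by
      have : 0 ≤ k ^ 5 * (k - 1 / 8) := mul_nonneg (by positivity) (by linarith)
      nlinarith
    linarith
  have heq : 4 * (((1 - x) ^ 2)⁻¹) ^ 2 * N ^ 3 * d⁻¹ = 4 * N ^ 3 / ((x - 1) ^ 4 * d) := by
    rw [div_eq_mul_inv, mul_inv, inv_pow]
    have : ((1 - x) ^ 2) ^ 2 = (x - 1) ^ 4 := by ring
    rw [this]
    ring
  rw [heq, le_div_iff₀ (by positivity), one_mul]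
  exact (mul_le_mul_of_nonneg_right h1 hd.le).trans hkey

end TwirlSwap

theorem mainTheorem6 (k q m ℓ : ℕ) (hq : 1 ≤ q) (hℓ : 2 * ℓ ≤ m) (hk : k ≤ q ^ m)
    (hk2 : k ^ 2 ≠ 2 * q ^ m) (a : ℝ)
    (ha : a = (1 - (k : ℝ) ^ 2 / (2 * (q : ℝ) ^ m)) ^ (-2 : ℤ)) :
    TwirlSwap.subspaceAngle k q m ℓ ≤
      Real.sqrt (9 * a * (k : ℝ) ^ 2 * (q : ℝ) ^ (-(m : ℤ)) +
        4 * a ^ 2 * (k.factorial : ℝ) ^ 3 * (q : ℝ) ^ (-(2 * ℓ : ℤ)) +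
        2 * a ^ 2 * (k.factorial : ℝ) ^ 5 * (q : ℝ) ^ (-(4 * ℓ : ℤ))) := by
  have hq1 : (1 : ℝ) ≤ q := by exact_mod_cast hq
  have hq0 : (0 : ℝ) < q := by linarith
  have hN : (1 : ℝ) ≤ k.factorial := by exact_mod_cast k.factorial_pos
  set x : ℝ := (k : ℝ) ^ 2 / (2 * (q : ℝ) ^ m) with hx
  have hx0 : 0 ≤ x := by positivity
  have ha' : a = ((1 - x) ^ 2)⁻¹ := by
    rw [ha, _root_.zpow_neg]
    norm_cast
  -- At `x = 1` the negative power defining `a` would take the default value `0`.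
  have hx1 : x ≠ 1 := by
    rw [hx, Ne, div_eq_one_iff_eq (by positivity)]
    exact_mod_cast hk2
  have ht : (q : ℝ) ^ (-(2 * ℓ : ℤ)) = ((q : ℝ) ^ (2 * ℓ))⁻¹ := by
    rw [_root_.zpow_neg]
    norm_cast
  have ha0 : 0 ≤ a := by rw [ha']; positivity
  rw [ht]
  set t : ℝ := ((q : ℝ) ^ (2 * ℓ))⁻¹ with htdef
  have ht0 : 0 < t := by positivity
  set B := 4 * a ^ 2 * (k.factorial : ℝ) ^ 3 * t with hB
  have hle : √B ≤ Real.sqrt (9 * a * (k : ℝ) ^ 2 * (q : ℝ) ^ (-(m : ℤ)) + B +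
      2 * a ^ 2 * (k.factorial : ℝ) ^ 5 * (q : ℝ) ^ (-(4 * ℓ : ℤ))) := by
    refine Real.sqrt_le_sqrt ?_
    have h1 : 0 ≤ 9 * a * (k : ℝ) ^ 2 * (q : ℝ) ^ (-(m : ℤ)) := by positivity
    have h2 : 0 ≤ 2 * a ^ 2 * (k.factorial : ℝ) ^ 5 * (q : ℝ) ^ (-(4 * ℓ : ℤ)) := by positivity
    linarith
  refine le_trans ?_ hle
  have htrivial : 1 ≤ B → TwirlSwap.subspaceAngle k q m ℓ ≤ √B := fun h =>
    (TwirlSwap.subspaceAngle_le zero_le_one fun X => by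
      rw [one_mul]; exact TwirlSwap.hsNorm_apply_le ℓ hq hk X).trans (Real.one_le_sqrt.2 h)
  rcases lt_or_gt_of_ne hx1 with hlt | hgt
  · have ha1 : 1 ≤ a := by
      rw [ha']
      refine (one_le_inv₀ (pow_pos (by linarith) 2)).2 (pow_le_one₀ (by linarith) (by linarith))
    set u := 4 * (k.factorial : ℝ) ^ 3 * t with hu
    have hu0 : 0 < u := by positivity
    have huB : u ≤ B := by
      have : B = a ^ 2 * u := by rw [hB, hu]; ring
      rw [this]
      exact le_mul_of_one_le_left hu0.le (one_le_pow₀ ha1)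
    by_cases hsmall : 1 ≤ u
    · exact htrivial (hsmall.trans huB)
    · rw [not_le] at hsmall
      have h23 : (k.factorial : ℝ) ^ 2 * t ≤ (k.factorial : ℝ) ^ 3 * t :=
        mul_le_mul_of_nonneg_right (pow_le_pow_right₀ hN (by norm_num)) ht0.le
      -- `u < 1` gives `(k!)² t ≤ (k!)³ t < 1/4`, the smallness hypothesis; then `8/3 ≤ 4` absorbs
      -- the constant.
      have hangle : TwirlSwap.subspaceAngle k q m ℓ ≤ u := by
        refine (TwirlSwap.subspaceAngle_le (by positivity)
          (TwirlSwap.hsNorm_apply_le_of_small hq hℓ hk (by linarith))).trans ?_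
        rw [← htdef]
        nlinarith
      refine hangle.trans (Real.le_sqrt_of_sq_le ?_)
      nlinarith
  · refine htrivial ?_
    have hd : (0 : ℝ) < (q : ℝ) ^ m := by positivity
    have hkd : (k : ℝ) ≤ (q : ℝ) ^ m := by exact_mod_cast hk
    -- For `k ≤ 1` one has `k² ≤ 1 < 2q^m`, against `x > 1`.
    have hk2' : 2 ≤ k := by
      by_contra! hlt
      have hk1 : (k : ℝ) ≤ 1 := by exact_mod_cast Nat.lt_succ_iff.1 hlt
      have hd1 : (1 : ℝ) ≤ (q : ℝ) ^ m := one_le_pow₀ hq1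
      rw [hx, lt_div_iff₀ (by positivity)] at hgt
      nlinarith [Nat.cast_nonneg (α := ℝ) k]
    have hfac : (k : ℝ) * (k - 1) ≤ k.factorial := by
      obtain ⟨n, rfl⟩ := Nat.exists_eq_add_of_le' hk2'
      have : (n + 2) * (n + 1) ≤ (n + 2).factorial := by
        rw [Nat.factorial_succ, Nat.factorial_succ]
        exact Nat.mul_le_mul_left _ (Nat.le_mul_of_pos_right _ n.factorial_pos)
      have h' : ((n + 2 : ℕ) : ℝ) * ((n + 1 : ℕ) : ℝ) ≤ (n + 2).factorial := by exact_mod_cast this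
      push_cast at h' ⊢
      linarith
    have h := TwirlSwap.one_le_bound_of_large hd (by exact_mod_cast hk2') hkd hx hgt hfac
    -- The hypothesis `2ℓ ≤ m` lets `t` replace the weaker factor `q^(-m)` in the scalar estimate.
    have htd : ((q : ℝ) ^ m)⁻¹ ≤ t := inv_anti₀ (by positivity) (pow_le_pow_right₀ hq1 hℓ)
    rw [← ha'] at h
    exact h.trans (mul_le_mul_of_nonneg_left htd (by positivity))
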